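/- Let $v_1,v_2,v_3$ be the vertices of an equilateral triangle in the plane, let $F_i(x)=\tfrac12(x-v_i)+v_i$ for $i\in\{1,2,3\}$, and let the Sierpinski gasket $G$ be the unique nonempty compact set with $G=F_1(G)\cup F_2(G)\cup F_3(G)$. Let $T$ be the solid closed triangle with vertices $v_1,v_2,v_3$; for a finite word $w=w_1\cdots w_n$ over $\{1,2,3\}$ put $F_w=F_{w_1}\circ\dots\circ F_{w_n}$ and $T_w=F_w(T)$ (with $T_\emptyset=T$). Let $V_m$ be the set of vertices of the triangles $T_w$ with $|w|=m$, and for distinct $x,y\in V_m$ write $x\sim_m y$ if $x$ and $y$ lie in a common $T_w$ with $|w|=m$. Let $\mathbb T=\mathbb R/\mathbb Z$. Let $\gamma_0=\partial T_\emptyset,\ \gamma_1=\partial T_1,\ \gamma_2=\partial T_2,\ \gamma_3=\partial T_3,\ \gamma_4=\partial T_{11},\dots$ be the loops $\partial T_w\subset G$, ordered by the length of $w$ and, for equal length, lexicographically. The loop $\partial T_w$ is parametrized by $c_w:[0,1]\to\partial T_w$ with constant speed, starting and ending at $F_w(v_1)$ and running $F_w(v_1)\to F_w(v_2)\to F_w(v_3)\to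 F_w(v_1)$. For a continuous $f:G\to\mathbb T$ let $\bar f_w:[0,1]\to\mathbb R$ be a continuous lift of $f\circ c_w$; the degree of $f$ on $\partial T_w$ is the integer $\omega_{\partial T_w}(f)=\bar f_w(1)-\bar f_w(0)$. These quantities, and the increments of $\bar f_w$ used below, do not depend on the choice of the lift. For $a\in\mathbb T$ let $\langle a\rangle\in(-\tfrac12,\tfrac12]$ be its real representative. A continuous map $f:G\to\mathbb T$ is called a harmonic map if $\Delta f=0$ on $G\setminus V_0$, that is, if the renormalized discrete Laplacians $$\tfrac32\,5^m\,\Delta_m f(x)=\tfrac32\,5^m\sum_{y\sim_m x}\langle f(y)-f(x)\rangle$$ converge to $0$ uniformly over $x\in V_m\setminus V_0$ as $m\to\infty$. **Theorem.** Let $\delta_1,\delta_2\in\mathbb R$, let $(\rho_0,\rho_1,\dots,\rho_n,0,0,\dots)$ be a finitely supported sequence of integers, and let $a\in\mathbb T$. Then there is exactly one harmonic map $f:G\to\mathbb T$ such that 1. $f(v_1)=a$; 2. $\bar f_{\emptyset}(1/3)-\bar f_{\emptyset}(0)=\delta_1$, $\ \bar f_{\emptyset}(2/3)-\bar f_{\emptyset}(1/3)=\delta_2$,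 $\ \bar f_{\emptyset}(1)-\bar f_{\emptyset}(2/3)=\rho_0-\delta_1-\delta_2$; 3. $\omega_{\gamma_i}(f)=\rho_i$ for all $i\ge 0$. Equivalently, a harmonic map satisfying 2 and 3 exists and is unique up to an additive constant in $\mathbb T$. -/

import Mathlib

/-- The Euclidean plane. -/
abbrev Plane : Type := EuclideanSpace ℝ (Fin 2)

/-- The points `v 0, v 1, v 2` (written `v₁, v₂, v₃` in the usual indexing) are the vertices of a
nondegenerate equilateral triangle. -/
def IsEquilateral (v : Fin 3 → Plane) : Prop :=
  ∃ s : ℝ, 0 < s ∧ ∀ i j : Fin 3, i ≠ j → dist (v i) (v j) = s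

namespace SG

/-! ### The gasket, its cells and approximating graphs -/

/-- The contraction `F_i` with ratio `1/2` and fixed point `v i`. -/
noncomputable def F (v : Fin 3 → Plane) (i : Fin 3) (x : Plane) : Plane :=
  (1 / 2 : ℝ) • (x - v i) + v i

/-- `F_w = F_{w₁} ∘ ⋯ ∘ F_{wₙ}` for a finite word `w`. -/
noncomputable def cellMap (v : Fin 3 → Plane) : List (Fin 3) → Plane → Plane
  | [] => id
  | i :: w => F v i ∘ cellMap v w

/-- The cell `T_w = F_w(T)`, where `T` is the solid closed triangle spanned by `v`. -/
def cell (v : Fin 3 → Plane) (w : List (Fin 3)) : Set Plane :=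
  cellMap v w '' convexHull ℝ (Set.range v)

/-- The Sierpinski gasket: the points that for every `n` lie in some `n`-cell.  By
`gasket_isCompact`, `gasket_nonempty`, `gasket_fixed` and `eq_gasket` below, it is the unique
nonempty compact set `G` with `G = ⋃ i, F_i(G)`. -/
def gasket (v : Fin 3 → Plane) : Set Plane :=
  {x | ∀ n : ℕ, ∃ w : List (Fin 3), w.length = n ∧ x ∈ cell v w}

/-- The set `V_m` of the vertices of all `m`-cells. -/
def vertexSet (v : Fin 3 → Plane) (m : ℕ) : Set Plane :=
  {x | ∃ w : List (Fin 3), w.length = m ∧ ∃ i : Fin 3, x = cellMap v w (v i)}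

/-- The graph `Γ_m`: two distinct points of `V_m` are adjacent if they lie in a common `m`-cell.
(Points of the gasket outside `V_m` are isolated.) -/
def graph (v : Fin 3 → Plane) (m : ℕ) : SimpleGraph (gasket v) where
  Adj x y := x ≠ y ∧ (x : Plane) ∈ vertexSet v m ∧ (y : Plane) ∈ vertexSet v m ∧
    ∃ w : List (Fin 3), w.length = m ∧ (x : Plane) ∈ cell v w ∧ (y : Plane) ∈ cell v w
  symm := ⟨fun _ _ h => ⟨h.1.symm, h.2.2.1, h.2.1, by
    obtain ⟨w, hw, hx, hy⟩ := h.2.2.2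
    exact ⟨w, hw, hy, hx⟩⟩⟩
  loopless := ⟨fun _ h => h.1 rfl⟩

/-! ### Basic facts -/

lemma F_continuous (v : Fin 3 → Plane) (i : Fin 3) : Continuous (F v i) := by
  unfold F; fun_prop

lemma cellMap_continuous (v : Fin 3 → Plane) (w : List (Fin 3)) : Continuous (cellMap v w) := by
  induction w with
  | nil => exact continuous_id
  | cons i w ih => exact (F_continuous v i).comp ih

lemma F_injective (v : Fin 3 → Plane) (i : Fin 3) : Function.Injective (F v i) := by
  intro x y h
  simpa [F] using h

lemma F_dist (v : Fin 3 → Plane) (i : Fin 3) (x y : Plane) :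
    dist (F v i x) (F v i y) = 1 / 2 * dist x y := by
  simp only [F, dist_add_right, dist_smul₀, dist_sub_right]
  norm_num

lemma F_lineMap_left (v : Fin 3 → Plane) (i : Fin 3) (y : Plane) (t : ℝ) :
    F v i (AffineMap.lineMap (v i) y t) = AffineMap.lineMap (v i) y (t / 2) := by
  simp only [F, AffineMap.lineMap_apply, vsub_eq_sub, vadd_eq_add]
  module

lemma F_mem_triangle (v : Fin 3 → Plane) (i : Fin 3) {x : Plane}
    (hx : x ∈ convexHull ℝ (Set.range v)) : F v i x ∈ convexHull ℝ (Set.range v) := by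
  have h := (convex_convexHull ℝ (Set.range v)) hx
    (subset_convexHull ℝ _ (Set.mem_range_self i))
    (show (0 : ℝ) ≤ 1 / 2 by norm_num) (show (0 : ℝ) ≤ 1 / 2 by norm_num) (by norm_num)
  convert h using 1
  unfold F
  module

lemma cellMap_mem_triangle (v : Fin 3 → Plane) (w : List (Fin 3)) {x : Plane}
    (hx : x ∈ convexHull ℝ (Set.range v)) : cellMap v w x ∈ convexHull ℝ (Set.range v) := by
  induction w with
  | nil => exact hx
  | cons i w ih => exact F_mem_triangle v i ih

lemma cellMap_append (v : Fin 3 → Plane) (w u : List (Fin 3)) (x : Plane) :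
    cellMap v (w ++ u) x = cellMap v w (cellMap v u x) := by
  induction w with
  | nil => rfl
  | cons i w ih => simp [cellMap, ih]

lemma cell_append_subset (v : Fin 3 → Plane) (w u : List (Fin 3)) :
    cell v (w ++ u) ⊆ cell v w := by
  rintro _ ⟨x, hx, rfl⟩
  exact ⟨cellMap v u x, cellMap_mem_triangle v u hx, (cellMap_append v w u x).symm⟩

lemma F_mem_gasket (v : Fin 3 → Plane) (i : Fin 3) {x : Plane} (hx : x ∈ gasket v) :
    F v i x ∈ gasket v := by
  intro n
  cases n with
  | zero =>
    obtain ⟨w, hw, y, hy, rfl⟩ := hx 0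
    exact ⟨[], rfl, _, F_mem_triangle v i (cellMap_mem_triangle v w hy), rfl⟩
  | succ n =>
    obtain ⟨w, hw, y, hy, rfl⟩ := hx n
    exact ⟨i :: w, by simp [hw], y, hy, rfl⟩

lemma cellMap_mem_gasket (v : Fin 3 → Plane) (w : List (Fin 3)) {x : Plane} (hx : x ∈ gasket v) :
    cellMap v w x ∈ gasket v := by
  induction w with
  | nil => exact hx
  | cons i w ih => exact F_mem_gasket v i ih

/-- The edges of the outer triangle lie in the gasket. -/
lemma edge_mem_gasket (v : Fin 3 → Plane) (i j : Fin 3) {t : ℝ} (ht : t ∈ Set.Icc (0 : ℝ) 1) :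
    AffineMap.lineMap (v i) (v j) t ∈ gasket v := by
  intro n
  induction n generalizing i j t with
  | zero =>
    refine ⟨[], rfl, _, ?_, rfl⟩
    exact (convex_convexHull ℝ (Set.range v)).lineMap_mem
      (subset_convexHull ℝ _ (Set.mem_range_self i))
      (subset_convexHull ℝ _ (Set.mem_range_self j)) ht
  | succ n ih =>
    have key : ∀ (a b : Fin 3) (s : ℝ), s ∈ Set.Icc (0 : ℝ) (1 / 2) →
        ∃ w : List (Fin 3), w.length = n + 1 ∧ AffineMap.lineMap (v a) (v b) s ∈ cell v w := by
      intro a b s hs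
      obtain ⟨w, hw, y, hy, hyx⟩ := ih a b (t := 2 * s) ⟨by linarith [hs.1], by linarith [hs.2]⟩
      refine ⟨a :: w, by simp [hw], y, hy, ?_⟩
      simp only [cellMap, Function.comp_apply, hyx, F_lineMap_left]
      congr 1
      ring
    rcases le_total t (1 / 2) with h | h
    · exact key i j t ⟨ht.1, h⟩
    · rw [← AffineMap.lineMap_apply_one_sub]
      exact key j i (1 - t) ⟨by linarith [ht.2], by linarith⟩

lemma vertex_mem_gasket (v : Fin 3 → Plane) (i : Fin 3) : v i ∈ gasket v := by
  simpa using edge_mem_gasket v i i (t := 0) ⟨le_rfl, zero_le_one⟩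

lemma gasket_nonempty (v : Fin 3 → Plane) : (gasket v).Nonempty := ⟨_, vertex_mem_gasket v 0⟩

lemma vertexSet_finite (v : Fin 3 → Plane) (m : ℕ) : (vertexSet v m).Finite := by
  have h : (Set.image2 (fun w i => cellMap v w (v i)) {w : List (Fin 3) | w.length = m}
      (Set.univ : Set (Fin 3))).Finite :=
    Set.Finite.image2 _ (List.finite_length_eq (Fin 3) m) Set.finite_univ
  refine h.subset ?_
  rintro x ⟨w, hw, i, rfl⟩
  exact ⟨w, hw, i, trivial, rfl⟩

lemma neighborSet_finite (v : Fin 3 → Plane) (m : ℕ) (x : gasket v) :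
    ((graph v m).neighborSet x).Finite := by
  refine ((vertexSet_finite v m).preimage Subtype.val_injective.injOn).subset ?_
  intro y hy
  exact hy.2.2.1

lemma gasket_isCompact (v : Fin 3 → Plane) : IsCompact (gasket v) := by
  have hT : IsCompact (convexHull ℝ (Set.range v)) := (Set.finite_range v).isCompact_convexHull ℝ
  have hc : ∀ w, IsCompact (cell v w) := fun w => hT.image (cellMap_continuous v w)
  have hn : ∀ n : ℕ, IsCompact (⋃ w ∈ {w : List (Fin 3) | w.length = n}, cell v w) := fun n =>
    (List.finite_length_eq (Fin 3) n).isCompact_biUnion fun w _ => hc w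
  have : gasket v = ⋂ n : ℕ, ⋃ w ∈ {w : List (Fin 3) | w.length = n}, cell v w := by
    ext x; simp [gasket]
  rw [this]
  exact (hn 0).of_isClosed_subset (isClosed_iInter fun n => (hn n).isClosed) (Set.iInter_subset _ 0)

lemma gasket_fixed (v : Fin 3 → Plane) : gasket v = ⋃ i, F v i '' gasket v := by
  apply Set.Subset.antisymm
  · intro x hx
    by_contra hcon
    have hsurj : ∀ i, ∃ y, F v i y = x := fun i => ⟨(2 : ℝ) • (x - v i) + v i, by
      unfold F; module⟩
    choose y hy using hsurj
    have hnot : ∀ i, y i ∉ gasket v := fun i hi =>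
      hcon (Set.mem_iUnion.2 ⟨i, y i, hi, hy i⟩)
    simp only [gasket, Set.mem_ofPred_eq, not_forall] at hnot
    choose n hn using hnot
    obtain ⟨w, hw, hxw⟩ := hx ((Finset.univ.sup n) + 1)
    cases w with
    | nil => simp at hw
    | cons i w =>
      have hlen : n i ≤ w.length := by
        have := Finset.le_sup (f := n) (Finset.mem_univ i)
        simp at hw; omega
      refine hn i ⟨w.take (n i), by simp [hlen], ?_⟩
      obtain ⟨z, hz, hzx⟩ := hxw
      have hyz : cellMap v w z = y i := F_injective v i (by rw [hy i]; exact hzx)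
      apply cell_append_subset v (w.take (n i)) (w.drop (n i))
      rw [List.take_append_drop]
      exact ⟨z, hz, hyz⟩
  · refine Set.iUnion_subset fun i => ?_
    rintro _ ⟨x, hx, rfl⟩
    exact F_mem_gasket v i hx

lemma subset_of_fixed (v : Fin 3 → Plane) {A B : Set Plane} (hA : IsCompact A)
    (hB : IsCompact B) (hBn : B.Nonempty) (hAF : A = ⋃ i, F v i '' A)
    (hBF : B = ⋃ i, F v i '' B) : A ⊆ B := by
  rcases A.eq_empty_or_nonempty with h | hAn
  · simp [h]
  obtain ⟨x, hx, hmax⟩ := hA.exists_isMaxOn hAn (Metric.continuous_infDist_pt B).continuousOn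
  have hle : Metric.infDist x B ≤ 1 / 2 * Metric.infDist x B := by
    rw [hAF] at hx
    obtain ⟨i, y, hy, hyx⟩ := Set.mem_iUnion.1 hx
    obtain ⟨b, hb, hbd⟩ := hB.exists_infDist_eq_dist hBn y
    have hFb : F v i b ∈ B := by rw [hBF]; exact Set.mem_iUnion.2 ⟨i, b, hb, rfl⟩
    calc Metric.infDist x B ≤ dist x (F v i b) := Metric.infDist_le_dist_of_mem hFb
      _ = 1 / 2 * Metric.infDist y B := by rw [← hyx, F_dist, hbd]
      _ ≤ 1 / 2 * Metric.infDist x B := by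
        have := hmax hy
        simp only [Set.mem_ofPred_eq] at this
        linarith
  intro a ha
  have h1 : Metric.infDist a B ≤ Metric.infDist x B := hmax ha
  have h2 : 0 ≤ Metric.infDist a B := Metric.infDist_nonneg
  exact (hB.isClosed.mem_iff_infDist_zero hBn).2 (by linarith)

lemma eq_gasket (v : Fin 3 → Plane) {K : Set Plane} (hK : IsCompact K) (hKn : K.Nonempty)
    (hKF : K = ⋃ i, F v i '' K) : K = gasket v :=
  Set.Subset.antisymm
    (subset_of_fixed v hK (gasket_isCompact v) (gasket_nonempty v) hKF (gasket_fixed v))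
    (subset_of_fixed v (gasket_isCompact v) hK hKn (gasket_fixed v) hKF)

/-- The boundary vertex `v i`, as a point of the gasket. -/
def vertex (v : Fin 3 → Plane) (i : Fin 3) : gasket v := ⟨v i, vertex_mem_gasket v i⟩

/-! ### Loops, lifts and degrees -/

/-- The piecewise linear function equal to `0` on `(-∞, 0]`, to `s` on `[0, 1]`, and to `1` on
`[1, ∞)`. -/
noncomputable def ramp (s : ℝ) : ℝ := max 0 (min 1 s)

/-- The uniform parametrization by `[0, 1]` of the boundary of the triangle `T`, which starts and
ends at `v 0` and runs through `v 0 → v 1 → v 2 → v 0`, reaching `v 1` at time `1/3` and `v 2` at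
time `2/3` (see `trianglePath_first`, `trianglePath_second`, `trianglePath_third`). -/
noncomputable def trianglePath (v : Fin 3 → Plane) (t : ℝ) : Plane :=
  v 0 + ramp (3 * t) • (v 1 - v 0) + ramp (3 * t - 1) • (v 2 - v 1) +
    ramp (3 * t - 2) • (v 0 - v 2)

lemma ramp_of_nonpos {s : ℝ} (h : s ≤ 0) : ramp s = 0 := by
  simp [ramp, h]

lemma ramp_of_one_le {s : ℝ} (h : 1 ≤ s) : ramp s = 1 := by
  simp [ramp, h]

lemma ramp_of_mem {s : ℝ} (h : s ∈ Set.Icc (0 : ℝ) 1) : ramp s = s := by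
  simp [ramp, h.1, h.2]

lemma trianglePath_first (v : Fin 3 → Plane) {t : ℝ} (ht : t ∈ Set.Icc (0 : ℝ) (1 / 3)) :
    trianglePath v t = AffineMap.lineMap (v 0) (v 1) (3 * t) := by
  rw [trianglePath, ramp_of_mem (s := 3 * t) ⟨by linarith [ht.1], by linarith [ht.2]⟩,
    ramp_of_nonpos (by linarith [ht.2]), ramp_of_nonpos (by linarith [ht.2]),
    AffineMap.lineMap_apply, vsub_eq_sub, vadd_eq_add]
  module

lemma trianglePath_second (v : Fin 3 → Plane) {t : ℝ} (ht : t ∈ Set.Icc (1 / 3 : ℝ) (2 / 3)) :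
    trianglePath v t = AffineMap.lineMap (v 1) (v 2) (3 * t - 1) := by
  rw [trianglePath, ramp_of_one_le (s := 3 * t) (by linarith [ht.1]),
    ramp_of_mem (s := 3 * t - 1) ⟨by linarith [ht.1], by linarith [ht.2]⟩,
    ramp_of_nonpos (by linarith [ht.2]), AffineMap.lineMap_apply, vsub_eq_sub, vadd_eq_add]
  module

lemma trianglePath_third (v : Fin 3 → Plane) {t : ℝ} (ht : t ∈ Set.Icc (2 / 3 : ℝ) 1) :
    trianglePath v t = AffineMap.lineMap (v 2) (v 0) (3 * t - 2) := by
  rw [trianglePath, ramp_of_one_le (s := 3 * t) (by linarith [ht.1]),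
    ramp_of_one_le (s := 3 * t - 1) (by linarith [ht.1]),
    ramp_of_mem (s := 3 * t - 2) ⟨by linarith [ht.1], by linarith [ht.2]⟩,
    AffineMap.lineMap_apply, vsub_eq_sub, vadd_eq_add]
  module

lemma trianglePath_continuous (v : Fin 3 → Plane) : Continuous (trianglePath v) := by
  unfold trianglePath ramp; fun_prop

lemma trianglePath_mem_gasket (v : Fin 3 → Plane) {t : ℝ} (ht : t ∈ Set.Icc (0 : ℝ) 1) :
    trianglePath v t ∈ gasket v := by
  rcases le_total t (1 / 3) with h1 | h1
  · rw [trianglePath_first v ⟨ht.1, h1⟩]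
    exact edge_mem_gasket v _ _ ⟨by linarith [ht.1], by linarith⟩
  rcases le_total t (2 / 3) with h2 | h2
  · rw [trianglePath_second v ⟨h1, h2⟩]
    exact edge_mem_gasket v _ _ ⟨by linarith, by linarith⟩
  · rw [trianglePath_third v ⟨h2, ht.2⟩]
    exact edge_mem_gasket v _ _ ⟨by linarith, by linarith [ht.2]⟩

/-- The uniform parametrization of the loop `∂T_w`, as a map from `[0, 1]` into the gasket. -/
noncomputable def loop (v : Fin 3 → Plane) (w : List (Fin 3)) : C(unitInterval, gasket v) where
  toFun t := ⟨cellMap v w (trianglePath v t),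
    cellMap_mem_gasket v w (trianglePath_mem_gasket v t.2)⟩
  continuous_toFun := Continuous.subtype_mk
    ((cellMap_continuous v w).comp ((trianglePath_continuous v).comp continuous_subtype_val)) _

/-- The lift of `f` along the loop `∂T_w`: the continuous function `φ : [0, 1] → ℝ` such that
`φ t` represents `f (loop v w t)` for all `t`, and `φ 0` lies in `[0, 1)`. -/
noncomputable def lift {v : Fin 3 → Plane} (f : C(gasket v, UnitAddCircle)) (w : List (Fin 3)) :
    C(unitInterval, ℝ) :=
  (AddCircle.isCoveringMap_coe (1 : ℝ)).liftPath (f.comp (loop v w))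
    (AddCircle.equivIco (1 : ℝ) 0 (f (loop v w 0))) AddCircle.coe_equivIco.symm

/-- The degree of `f` on the loop `∂T_w` (an integer, here as a real number). -/
noncomputable def degree {v : Fin 3 → Plane} (f : C(gasket v, UnitAddCircle))
    (w : List (Fin 3)) : ℝ :=
  lift f w 1 - lift f w 0

/-- The increments of the lift of `f` along the three sides of the outer triangle:
`∂_{v₁v₂} f`, `∂_{v₂v₃} f` and `∂_{v₃v₁} f` for `k = 0, 1, 2`. -/
noncomputable def sideIncrement {v : Fin 3 → Plane} (f : C(gasket v, UnitAddCircle))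
    (k : Fin 3) : ℝ :=
  lift f [] (Set.projIcc 0 1 zero_le_one (((k : ℕ) + 1 : ℝ) / 3)) -
    lift f [] (Set.projIcc 0 1 zero_le_one (((k : ℕ) : ℝ) / 3))

/-- The position of `∂T_w` in the enumeration `γ₀, γ₁, γ₂, …` of the loops by the length of `w`
and, for equal lengths, lexicographically: `γ₀ = ∂T_∅`, `γ₁ = ∂T₁`, `γ₂ = ∂T₂`, `γ₃ = ∂T₃`,
`γ₄ = ∂T₁₁`, `γ₅ = ∂T₁₂`, and so on. -/
def loopIndex (w : List (Fin 3)) : ℕ := w.foldl (fun n i => 3 * n + ((i : ℕ) + 1)) 0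

/-! ### Harmonic maps -/

/-- The representative in `(-1/2, 1/2]` of an element of the circle `ℝ / ℤ`. -/
noncomputable def signedRep (a : UnitAddCircle) : ℝ :=
  (AddCircle.equivIoc (1 : ℝ) (-(1 / 2)) a : ℝ)

/-- The discrete Laplacian `Δ_m f (x) = ∑_{y ∼_m x} (f y - f x)` of a circle-valued map, where the
differences are measured by their real representatives of smallest absolute value.  For a
continuous `f` and large `m` these are the differences of every local real-valued lift of `f`. -/
noncomputable def discreteLaplacian {v : Fin 3 → Plane} (m : ℕ)
    (f : C(gasket v, UnitAddCircle)) (x : gasket v) : ℝ :=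
  ∑ᶠ y ∈ (graph v m).neighborSet x, signedRep (f y - f x)

/-- `Δ f = g` on `G \ V₀`: the function `g` is continuous and is the uniform limit of the
renormalized discrete Laplacians `(3/2) 5^m Δ_m f` at the interior nodes of `Γ_m`. -/
def HasLaplacian {v : Fin 3 → Plane} (f : C(gasket v, UnitAddCircle)) (g : gasket v → ℝ) : Prop :=
  Continuous g ∧ ∀ ε > 0, ∃ M : ℕ, ∀ m ≥ M, ∀ x : gasket v,
    (x : Plane) ∈ vertexSet v m \ vertexSet v 0 →
      |3 / 2 * 5 ^ m * discreteLaplacian m f x - g x| < ε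

/-- A harmonic map from the gasket to the circle: a solution of `Δ f = 0` on `G \ V₀`. -/
def IsHarmonicMap {v : Fin 3 → Plane} (f : C(gasket v, UnitAddCircle)) : Prop :=
  HasLaplacian f 0

end SG

/-!
Existence and uniqueness of harmonic maps from the Sierpinski gasket to the circle with prescribed
degrees.  Everything rests on self-similarity: a continuous map `f` on the gasket is the same as
three maps `f ∘ F_k` that match at the three junction points (`exists_glue`), and increments,
degrees, edges and discrete Laplacians of `f` are expressed by those of the `f ∘ F_k`
(`sideIncrement_eq_add`, `degree_cons`, `edgeSum_succ`, `starSum_incl`, `starSum_junction`).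

*Existence* is by induction on the length of the words that carry a nonzero degree
(`exists_eventuallyHarmonic`).  If all degrees vanish, a real-valued harmonic function does it
(`exists_harmonicExtension`).  Otherwise, harmonic maps on the three first-level cells with the
right degrees are available, for all increments along the sides of these cells.  Such maps are glued
to a harmonic map if their normal derivatives cancel at the junction points.  The normal derivatives
depend affinely on the increments, with the same linear part as for real-valued functions, so that
cancellation is a linear `3 × 3` system for the positions of the three junction values; it is
solved explicitly.  The matching condition around the hole holds modulo `1` because the degrees are
integers.

*Uniqueness*: the difference of two solutions has degree zero on all loops, hence is represented
by a real-valued function `h` (`exists_toCircle_eq`), which vanishes at the corners up to a constant,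
and for which `5 ^ m` times the discrete Laplacian tends to zero uniformly.  Summation by parts
bounds the energy of `h` on `Γ_m` by `o((3/5)^m)`, whereas `(5/3)^m` times this energy increases
with `m`.  So all energies vanish and `h` is constant (`eq_zero_of_laplacian_tendsto_zero`).
-/

namespace SG

/-! ### Geometry of the first-level cells -/

lemma exists_affineBasis {v : Fin 3 → Plane} (hv : IsEquilateral v) :
    ∃ b : AffineBasis (Fin 3) ℝ Plane, ∀ i, b i = v i := by
  obtain ⟨s, hs, hd⟩ := hv
  have key : ∀ i j : Fin 3, i ≠ j → inner ℝ (v i - v j) (v i - v j) = s ^ 2 := by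
    intro i j h
    rw [real_inner_self_eq_norm_sq, ← dist_eq_norm, hd i j h]
  have h1 := key 1 0 (by decide)
  have h2 := key 2 0 (by decide)
  have h12 := key 1 2 (by decide)
  rw [show v 1 - v 2 = (v 1 - v 0) - (v 2 - v 0) by abel, inner_sub_sub_self] at h12
  set e₁ := v 1 - v 0 with he₁
  set e₂ := v 2 - v 0 with he₂
  have hc : inner ℝ e₂ e₁ = inner ℝ e₁ e₂ := real_inner_comm _ _
  have hs2 : 0 < s ^ 2 := by positivity
  have hind : AffineIndependent ℝ v := by
    rw [affineIndependent_iff]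
    intro t w hw0 hw i hi
    classical
    have key2 : ∀ u : Fin 3 → ℝ, ∑ i, u i = 0 → ∑ i, u i • v i = 0 → u = 0 := by
      intro u hu0 hu
      rw [Fin.sum_univ_three] at hu0 hu
      have h3 : u 1 • e₁ + u 2 • e₂ = 0 := by
        rw [← hu, he₁, he₂, show u 0 = -u 1 - u 2 by linarith]
        module
      have i1 := congrArg (fun z => inner ℝ e₁ z) h3
      have i2 := congrArg (fun z => inner ℝ e₂ z) h3
      simp only [inner_add_right, inner_smul_right, inner_zero_right] at i1 i2
      rw [h1] at i1
      rw [h2, hc] at i2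
      have h4 : inner ℝ e₁ e₂ = s ^ 2 / 2 := by linarith
      rw [h4] at i1 i2
      have hu1 : u 1 = 0 := by
        have : u 1 * s ^ 2 = 0 := by linarith
        exact (mul_eq_zero.1 this).resolve_right hs2.ne'
      have hu2 : u 2 = 0 := by
        have : u 2 * s ^ 2 = 0 := by linarith
        exact (mul_eq_zero.1 this).resolve_right hs2.ne'
      funext j
      fin_cases j
      · simp; linarith
      · exact hu1
      · exact hu2
    have := key2 (fun i => if i ∈ t then w i else 0) (by simpa using hw0)
      (by simpa [ite_smul] using hw)
    simpa [hi] using congrFun this i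
  refine ⟨⟨v, hind, ?_⟩, fun _ => rfl⟩
  rw [hind.affineSpan_eq_top_iff_card_eq_finrank_add_one]
  simp

/-- Two different first-level cells meet at most in the midpoint of a side of `T`. -/
lemma eq_vertex_of_F_eq {v : Fin 3 → Plane} (hv : IsEquilateral v) {k l : Fin 3} (hkl : k ≠ l)
    {x y : Plane} (hx : x ∈ convexHull ℝ (Set.range v)) (hy : y ∈ convexHull ℝ (Set.range v))
    (h : F v k x = F v l y) : x = v l := by
  obtain ⟨b, hb⟩ := exists_affineBasis hv
  have hbv : Set.range b = Set.range v := by congr 1; funext i; exact hb i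
  rw [← hbv, b.convexHull_eq_nonneg_coord] at hx hy
  have hF : ∀ (k i : Fin 3) (z : Plane),
      b.coord i (F v k z) = (b.coord i z + if i = k then 1 else 0) / 2 := by
    intro k i z
    have : F v k z = AffineMap.lineMap z (v k) (1 / 2 : ℝ) := by
      simp only [F, AffineMap.lineMap_apply, vsub_eq_sub, vadd_eq_add]; module
    rw [this, AffineMap.apply_lineMap, ← hb k, b.coord_apply, AffineMap.lineMap_apply]
    simp only [vsub_eq_sub, vadd_eq_add, smul_eq_mul]
    ring
  have h1 : ∀ i, b.coord i x + (if i = k then 1 else 0) =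
      b.coord i y + if i = l then 1 else 0 := by
    intro i
    have := congrArg (b.coord i) h
    rw [hF, hF] at this
    linarith
  have hl : 1 ≤ b.coord l x := by
    have := h1 l
    rw [if_neg hkl.symm, if_pos rfl] at this
    linarith [hy l]
  have hsum := b.sum_coord_apply_eq_one x
  rw [← hb l]
  refine b.ext_elem fun i => ?_
  rw [b.coord_apply]
  have hrest : ∀ j, j ≠ l → b.coord j x ≤ 0 := by
    intro j hj
    have := Finset.add_le_sum (s := Finset.univ) (f := fun i => b.coord i x)
      (fun i _ => hx i) (Finset.mem_univ j) (Finset.mem_univ l) hj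
    linarith
  split_ifs with hil
  · subst hil
    refine le_antisymm ?_ hl
    have := Finset.single_le_sum (s := Finset.univ) (f := fun i => b.coord i x)
      (fun i _ => hx i) (Finset.mem_univ i)
    linarith
  · exact le_antisymm (hrest i hil) (hx i)

lemma vertices_injective {v : Fin 3 → Plane} (hv : IsEquilateral v) : Function.Injective v := by
  obtain ⟨b, hb⟩ := exists_affineBasis hv
  have : v = b := funext fun i => (hb i).symm
  rw [this]
  exact b.ind.injective

lemma vertex_injective {v : Fin 3 → Plane} (hv : IsEquilateral v) :
    Function.Injective (vertex v) :=
  fun _ _ h => vertices_injective hv (congrArg Subtype.val h)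

lemma gasket_subset_triangle (v : Fin 3 → Plane) : gasket v ⊆ convexHull ℝ (Set.range v) := by
  intro x hx
  obtain ⟨w, -, y, hy, rfl⟩ := hx 0
  exact cellMap_mem_triangle v w hy

/-- The contraction `F_k`, as a continuous self-map of the gasket. -/
noncomputable def incl (v : Fin 3 → Plane) (k : Fin 3) : C(gasket v, gasket v) where
  toFun x := ⟨F v k x, F_mem_gasket v k x.2⟩
  continuous_toFun := Continuous.subtype_mk ((F_continuous v k).comp continuous_subtype_val) _

@[simp] lemma coe_incl (v : Fin 3 → Plane) (k : Fin 3) (x : gasket v) :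
    (incl v k x : Plane) = F v k x := rfl

lemma incl_injective (v : Fin 3 → Plane) (k : Fin 3) : Function.Injective (incl v k) :=
  fun _ _ h => Subtype.ext (F_injective v k (congrArg Subtype.val h))

@[simp] lemma F_self (v : Fin 3 → Plane) (k : Fin 3) : F v k (v k) = v k := by simp [F]

lemma F_vertex_comm (v : Fin 3 → Plane) (k l : Fin 3) : F v k (v l) = F v l (v k) := by
  simp only [F]; module

@[simp] lemma incl_vertex_self (v : Fin 3 → Plane) (k : Fin 3) :
    incl v k (vertex v k) = vertex v k := Subtype.ext (F_self v k)

lemma incl_vertex_comm (v : Fin 3 → Plane) (k l : Fin 3) :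
    incl v k (vertex v l) = incl v l (vertex v k) := Subtype.ext (F_vertex_comm v k l)

lemma eq_vertex_of_incl_eq {v : Fin 3 → Plane} (hv : IsEquilateral v) {k l : Fin 3} (hkl : k ≠ l)
    {x y : gasket v} (h : incl v k x = incl v l y) : x = vertex v l :=
  Subtype.ext (eq_vertex_of_F_eq hv hkl (gasket_subset_triangle v x.2)
    (gasket_subset_triangle v y.2) (congrArg Subtype.val h))

lemma exists_incl_eq {v : Fin 3 → Plane} (x : gasket v) : ∃ k y, incl v k y = x := by
  have hx : (x : Plane) ∈ ⋃ i, F v i '' gasket v := (gasket_fixed v).subset x.2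
  obtain ⟨k, y, hy, hyx⟩ := Set.mem_iUnion.1 hx
  exact ⟨k, ⟨y, hy⟩, Subtype.ext hyx⟩

instance (v : Fin 3 → Plane) : CompactSpace (gasket v) :=
  isCompact_iff_compactSpace.1 (gasket_isCompact v)

/-- Three continuous maps on the gasket that match at the junction points are the restrictions
of one continuous map to the three first-level cells. -/
theorem exists_glue {X : Type*} [TopologicalSpace X] {v : Fin 3 → Plane} (hv : IsEquilateral v)
    (g : Fin 3 → C(gasket v, X))
    (hg : ∀ k l, g k (vertex v l) = g l (vertex v k)) :
    ∃ f : C(gasket v, X), ∀ k, f.comp (incl v k) = g k := by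
  let q : C((_ : Fin 3) × gasket v, gasket v) := ContinuousMap.sigma (incl v)
  let G : C((_ : Fin 3) × gasket v, X) := ContinuousMap.sigma g
  have hq : Topology.IsQuotientMap q := by
    refine (q.continuous.isClosedMap).isQuotientMap q.continuous ?_
    intro x
    obtain ⟨k, y, h⟩ := exists_incl_eq x
    exact ⟨⟨k, y⟩, h⟩
  have hG : Function.FactorsThrough G q := by
    rintro ⟨k, x⟩ ⟨l, y⟩ h
    change incl v k x = incl v l y at h
    change g k x = g l y
    by_cases hkl : k = l
    · subst hkl
      rw [incl_injective v k h]
    · rw [eq_vertex_of_incl_eq hv hkl h, eq_vertex_of_incl_eq hv (Ne.symm hkl) h.symm, hg]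
  refine ⟨hq.lift G hG, fun k => ?_⟩
  ext y
  exact congrArg (fun F => F ⟨k, y⟩) (hq.lift_comp G hG)

/-! ### Sums over the edges of the approximating graphs -/

lemma vertexSet_subset_gasket (v : Fin 3 → Plane) (m : ℕ) : vertexSet v m ⊆ gasket v := by
  rintro _ ⟨w, -, i, rfl⟩
  exact cellMap_mem_gasket v w (vertex_mem_gasket v i)

lemma vertex_mem_vertexSet (v : Fin 3 → Plane) (i : Fin 3) (m : ℕ) : v i ∈ vertexSet v m := by
  refine ⟨List.replicate m i, by simp, i, ?_⟩
  induction m with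
  | zero => rfl
  | succ m ih => simp [List.replicate_succ, cellMap, ← ih]

lemma F_mem_vertexSet {v : Fin 3 → Plane} {k : Fin 3} {m : ℕ} {x : Plane}
    (hx : x ∈ vertexSet v m) : F v k x ∈ vertexSet v (m + 1) := by
  obtain ⟨w, hw, i, rfl⟩ := hx
  exact ⟨k :: w, by simp [hw], i, rfl⟩

lemma mem_vertexSet_succ {v : Fin 3 → Plane} {m : ℕ} {x : Plane} :
    x ∈ vertexSet v (m + 1) ↔ ∃ k, ∃ y ∈ vertexSet v m, F v k y = x := by
  constructor
  · rintro ⟨w, hw, i, rfl⟩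
    cases w with
    | nil => simp at hw
    | cons k w => exact ⟨k, _, ⟨w, by simpa using hw, i, rfl⟩, rfl⟩
  · rintro ⟨k, y, hy, rfl⟩
    exact F_mem_vertexSet hy

lemma mem_vertexSet_of_F_mem {v : Fin 3 → Plane} (hv : IsEquilateral v) {k : Fin 3} {m : ℕ}
    {x : Plane} (hx : x ∈ convexHull ℝ (Set.range v)) (h : F v k x ∈ vertexSet v (m + 1)) :
    x ∈ vertexSet v m := by
  obtain ⟨l, y, hy, hyx⟩ := mem_vertexSet_succ.1 h
  by_cases hkl : k = l
  · subst hkl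
    rwa [← F_injective v k hyx]
  · rw [eq_vertex_of_F_eq hv hkl hx
      (gasket_subset_triangle v (vertexSet_subset_gasket v m hy)) hyx.symm]
    exact vertex_mem_vertexSet v l m

lemma mem_vertexSet_zero {v : Fin 3 → Plane} {x : Plane} :
    x ∈ vertexSet v 0 ↔ ∃ i, x = v i := by
  constructor
  · rintro ⟨w, hw, i, rfl⟩
    obtain rfl := List.length_eq_zero_iff.1 hw
    exact ⟨i, rfl⟩
  · rintro ⟨i, rfl⟩
    exact vertex_mem_vertexSet v i 0

/-- The oriented edges of the graph `Γ_m`. -/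
def edges (v : Fin 3 → Plane) (m : ℕ) : Set (gasket v × gasket v) :=
  {p | (graph v m).Adj p.1 p.2}

lemma edges_finite (v : Fin 3 → Plane) (m : ℕ) : (edges v m).Finite := by
  have h := (vertexSet_finite v m).preimage (f := ((↑) : gasket v → Plane))
    Subtype.val_injective.injOn
  exact (h.prod h).subset fun p hp => ⟨hp.2.1, hp.2.2.1⟩

lemma edges_zero (v : Fin 3 → Plane) :
    edges v 0 = {p | ∃ i j, v i ≠ v j ∧ p = (vertex v i, vertex v j)} := by
  ext ⟨x, y⟩
  constructor
  · rintro ⟨hxy, hx, hy, -⟩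
    obtain ⟨i, hi⟩ := mem_vertexSet_zero.1 hx
    obtain ⟨j, hj⟩ := mem_vertexSet_zero.1 hy
    refine ⟨i, j, fun h => hxy (Subtype.ext ?_), Prod.ext (Subtype.ext hi) (Subtype.ext hj)⟩
    change (x : Plane) = y
    exact (hi.trans h).trans hj.symm
  · rintro ⟨i, j, hij, h⟩
    obtain ⟨rfl, rfl⟩ := Prod.mk.inj h
    refine ⟨fun h => hij (congrArg Subtype.val h), vertex_mem_vertexSet v i 0,
      vertex_mem_vertexSet v j 0, [], rfl, ?_, ?_⟩
    · exact ⟨v i, subset_convexHull ℝ _ (Set.mem_range_self i), rfl⟩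
    · exact ⟨v j, subset_convexHull ℝ _ (Set.mem_range_self j), rfl⟩

lemma edges_succ {v : Fin 3 → Plane} (hv : IsEquilateral v) (m : ℕ) :
    edges v (m + 1) = ⋃ k, Prod.map (incl v k) (incl v k) '' edges v m := by
  ext ⟨x, y⟩
  simp only [Set.mem_iUnion]
  constructor
  · rintro ⟨hxy, hx, hy, w, hw, hxw, hyw⟩
    cases w with
    | nil => simp at hw
    | cons k w =>
      obtain ⟨x₀, hx₀, hx'⟩ := hxw
      obtain ⟨y₀, hy₀, hy'⟩ := hyw
      change F v k (cellMap v w x₀) = x at hx'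
      change F v k (cellMap v w y₀) = y at hy'
      have hxV := mem_vertexSet_of_F_mem hv (cellMap_mem_triangle v w hx₀) (hx' ▸ hx)
      have hyV := mem_vertexSet_of_F_mem hv (cellMap_mem_triangle v w hy₀) (hy' ▸ hy)
      refine ⟨k, (⟨_, vertexSet_subset_gasket v m hxV⟩, ⟨_, vertexSet_subset_gasket v m hyV⟩),
        ⟨fun h => hxy ?_, hxV, hyV, w, by simpa using hw, ⟨x₀, hx₀, rfl⟩, ⟨y₀, hy₀, rfl⟩⟩,
        Prod.ext (Subtype.ext hx') (Subtype.ext hy')⟩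
      apply Subtype.ext
      change (x : Plane) = y
      have h2 : cellMap v w x₀ = cellMap v w y₀ := congrArg Subtype.val h
      rw [← hx', ← hy', h2]
  · rintro ⟨k, ⟨x', y'⟩, ⟨hne, hx, hy, w, hw, ⟨x₀, hx₀, hxw⟩, ⟨y₀, hy₀, hyw⟩⟩, h⟩
    obtain ⟨rfl, rfl⟩ := Prod.mk.inj h
    refine ⟨fun h => hne (incl_injective v k h), F_mem_vertexSet hx, F_mem_vertexSet hy, k :: w,
      by simp [hw], ⟨x₀, hx₀, ?_⟩, ⟨y₀, hy₀, ?_⟩⟩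
    · exact congrArg (F v k) hxw
    · exact congrArg (F v k) hyw

/-- The sum of `φ` over all oriented edges of `Γ_m`. -/
noncomputable def edgeSum (v : Fin 3 → Plane) (m : ℕ) (φ : gasket v × gasket v → ℝ) : ℝ :=
  ∑ᶠ p ∈ edges v m, φ p

lemma edgeSum_zero {v : Fin 3 → Plane} (hv : IsEquilateral v) (φ : gasket v × gasket v → ℝ) :
    edgeSum v 0 φ = ∑ i, ∑ j, if i = j then 0 else φ (vertex v i, vertex v j) := by
  classical
  have h : edges v 0 = ((Finset.univ.filter fun p : Fin 3 × Fin 3 => p.1 ≠ p.2).image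
      fun p => (vertex v p.1, vertex v p.2) : Finset (gasket v × gasket v)) := by
    rw [edges_zero]
    ext p
    simp only [ne_eq, Set.mem_ofPred_eq, Finset.coe_image, Finset.coe_filter, Finset.mem_univ,
      true_and, Set.mem_image, Prod.exists]
    constructor
    · rintro ⟨i, j, hij, rfl⟩
      exact ⟨i, j, fun h => hij (by rw [h]), rfl⟩
    · rintro ⟨i, j, hij, rfl⟩
      exact ⟨i, j, fun h => hij (vertices_injective hv h), rfl⟩
  rw [edgeSum, h, finsum_mem_coe_finset, Finset.sum_image, Finset.sum_filter,
    Fintype.sum_prod_type]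
  · simp only [ne_eq, ite_not]
  · rintro ⟨i, j⟩ - ⟨i', j'⟩ - h
    obtain ⟨h1, h2⟩ := Prod.mk.inj h
    exact Prod.ext (vertex_injective hv h1) (vertex_injective hv h2)

/-- The oriented edges of `Γ_{m+1}` are the disjoint union of three copies of those of `Γ_m`. -/
lemma edgeSum_succ {v : Fin 3 → Plane} (hv : IsEquilateral v) (m : ℕ)
    (φ : gasket v × gasket v → ℝ) :
    edgeSum v (m + 1) φ = ∑ k, edgeSum v m (φ ∘ Prod.map (incl v k) (incl v k)) := by
  unfold edgeSum
  rw [edges_succ hv, finsum_mem_iUnion, finsum_eq_sum_of_fintype]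
  · refine Finset.sum_congr rfl fun k _ => ?_
    rw [finsum_mem_image]
    · rfl
    · exact ((incl_injective v k).prodMap (incl_injective v k)).injOn
  · intro k l hkl
    refine Set.disjoint_left.2 ?_
    rintro _ ⟨⟨x, y⟩, hp, rfl⟩ ⟨⟨x', y'⟩, hp', h⟩
    obtain ⟨h1, h2⟩ := Prod.mk.inj h
    refine hp.1 ?_
    exact (eq_vertex_of_incl_eq hv hkl h1.symm).trans (eq_vertex_of_incl_eq hv hkl h2.symm).symm
  · exact fun k => (edges_finite v m).image _

lemma edgeSum_congr {v : Fin 3 → Plane} {m : ℕ} {φ ψ : gasket v × gasket v → ℝ}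
    (h : ∀ p ∈ edges v m, φ p = ψ p) : edgeSum v m φ = edgeSum v m ψ :=
  finsum_mem_congr rfl h

lemma edgeSum_add {v : Fin 3 → Plane} {m : ℕ} (φ ψ : gasket v × gasket v → ℝ) :
    edgeSum v m (fun p => φ p + ψ p) = edgeSum v m φ + edgeSum v m ψ :=
  finsum_mem_add_distrib (edges_finite v m)

lemma edgeSum_const_mul {v : Fin 3 → Plane} {m : ℕ} (c : ℝ) (φ : gasket v × gasket v → ℝ) :
    edgeSum v m (fun p => c * φ p) = c * edgeSum v m φ :=
  (mul_finsum_mem _ c).symm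

lemma edgeSum_swap {v : Fin 3 → Plane} {m : ℕ} (φ : gasket v × gasket v → ℝ) :
    edgeSum v m (fun p => φ p.swap) = edgeSum v m φ := by
  unfold edgeSum
  refine finsum_mem_eq_of_bijOn Prod.swap ⟨?_, Prod.swap_injective.injOn, ?_⟩ fun _ _ => rfl
  · exact fun p hp => (graph v m).symm.symm _ _ hp
  · exact fun p hp => ⟨p.swap, (graph v m).symm.symm _ _ hp, Prod.swap_swap p⟩

open Classical in
/-- The graph Laplacian at `x` with a general edge function: the sum of `φ (x, y)` over the
neighbours `y` of `x` in `Γ_m`. -/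
noncomputable def starSum (v : Fin 3 → Plane) (m : ℕ) (φ : gasket v × gasket v → ℝ)
    (x : gasket v) : ℝ :=
  edgeSum v m fun p => if p.1 = x then φ p else 0

lemma discreteLaplacian_eq_starSum {v : Fin 3 → Plane} (m : ℕ) (f : C(gasket v, UnitAddCircle))
    (x : gasket v) :
    discreteLaplacian m f x = starSum v m (fun p => signedRep (f p.2 - f p.1)) x := by
  classical
  have h1 : discreteLaplacian m f x =
      ∑ᶠ p ∈ Prod.mk x '' (graph v m).neighborSet x, signedRep (f p.2 - f p.1) := by
    rw [finsum_mem_image (Prod.mk_right_injective x).injOn]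
    rfl
  rw [h1, starSum, edgeSum]
  have h2 : Prod.mk x '' (graph v m).neighborSet x = edges v m ∩ {p | p.1 = x} := by
    ext ⟨a, b⟩
    constructor
    · rintro ⟨y, hy, h⟩
      obtain ⟨rfl, rfl⟩ := Prod.mk.inj h
      exact ⟨hy, rfl⟩
    · rintro ⟨h, h'⟩
      change a = x at h'
      subst h'
      exact ⟨b, h, rfl⟩
  rw [h2]
  refine finsum_congr fun p => ?_
  by_cases hp : p ∈ edges v m <;> by_cases hx : p.1 = x <;> simp [hp, hx]

/-- A star around a point that is not a junction point with another cell lies in one cell. -/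
lemma starSum_incl {v : Fin 3 → Plane} (hv : IsEquilateral v) (m : ℕ)
    (φ : gasket v × gasket v → ℝ) (k : Fin 3) (x : gasket v)
    (hx : ∀ l, l ≠ k → x ≠ vertex v l) :
    starSum v (m + 1) φ (incl v k x) =
      starSum v m (φ ∘ Prod.map (incl v k) (incl v k)) x := by
  unfold starSum
  rw [edgeSum_succ hv, Finset.sum_eq_single k]
  · refine edgeSum_congr fun p _ => ?_
    simp [(incl_injective v k).eq_iff]
  · intro l _ hl
    rw [edgeSum_congr (ψ := fun _ => 0)]
    · simp [edgeSum]
    · intro p _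
      refine if_neg fun h => hx l hl ?_
      exact eq_vertex_of_incl_eq hv hl.symm h.symm
  · simp

lemma starSum_vertex {v : Fin 3 → Plane} (hv : IsEquilateral v) (m : ℕ)
    (φ : gasket v × gasket v → ℝ) (k : Fin 3) :
    starSum v (m + 1) φ (vertex v k) =
      starSum v m (φ ∘ Prod.map (incl v k) (incl v k)) (vertex v k) := by
  conv_lhs => rw [← incl_vertex_self]
  exact starSum_incl hv m φ k _ fun l hl h => hl (vertex_injective hv h).symm

/-- A star around a junction point consists of two halves, one in each of the two cells that
meet there. -/
lemma starSum_junction {v : Fin 3 → Plane} (hv : IsEquilateral v) (m : ℕ)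
    (φ : gasket v × gasket v → ℝ) {k l : Fin 3} (hkl : k ≠ l) :
    starSum v (m + 1) φ (incl v k (vertex v l)) =
      starSum v m (φ ∘ Prod.map (incl v k) (incl v k)) (vertex v l) +
      starSum v m (φ ∘ Prod.map (incl v l) (incl v l)) (vertex v k) := by
  unfold starSum
  rw [edgeSum_succ hv, Fintype.sum_eq_add k l hkl]
  · congr 1
    · refine edgeSum_congr fun p _ => ?_
      simp [(incl_injective v k).eq_iff]
    · refine edgeSum_congr fun p _ => ?_
      rw [incl_vertex_comm]
      simp [(incl_injective v l).eq_iff]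
  · rintro j ⟨hjk, hjl⟩
    rw [edgeSum_congr (ψ := fun _ => 0)]
    · simp [edgeSum]
    · intro p _
      refine if_neg fun h => hjl ?_
      exact (vertex_injective hv (eq_vertex_of_incl_eq hv hjk.symm h.symm)).symm

/-- Every vertex of level `m + 1` is a corner of `T`, a junction point, or a vertex of level `m`
in the interior of a first-level cell. -/
lemma vertexSet_succ_cases {v : Fin 3 → Plane} {m : ℕ} {x : gasket v}
    (hx : (x : Plane) ∈ vertexSet v (m + 1) \ vertexSet v 0) :
    (∃ k l, k ≠ l ∧ x = incl v k (vertex v l)) ∨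
      ∃ (k : Fin 3) (y : gasket v), (y : Plane) ∈ vertexSet v m \ vertexSet v 0 ∧
        x = incl v k y := by
  obtain ⟨k, y, hy, hyx⟩ := mem_vertexSet_succ.1 hx.1
  by_cases h0 : y ∈ vertexSet v 0
  · obtain ⟨l, rfl⟩ := mem_vertexSet_zero.1 h0
    refine Or.inl ⟨k, l, ?_, Subtype.ext hyx.symm⟩
    rintro rfl
    rw [F_self] at hyx
    exact hx.2 (hyx ▸ vertex_mem_vertexSet v k 0)
  · exact Or.inr ⟨k, ⟨y, vertexSet_subset_gasket v m hy⟩, ⟨hy, h0⟩, Subtype.ext hyx.symm⟩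

lemma ne_vertex_of_notMem {v : Fin 3 → Plane} {x : gasket v} (hx : (x : Plane) ∉ vertexSet v 0)
    (l : Fin 3) : x ≠ vertex v l := by
  rintro rfl
  exact hx (vertex_mem_vertexSet v l 0)

/-! ### Increments along the sides, and degrees -/

lemma coe_signedRep (a : UnitAddCircle) : (signedRep a : UnitAddCircle) = a :=
  AddCircle.coe_equivIoc

lemma signedRep_coe {r : ℝ} (hr : |r| < 1 / 2) : signedRep (r : UnitAddCircle) = r := by
  obtain ⟨h1, h2⟩ := abs_lt.1 hr
  rw [signedRep, AddCircle.equivIoc_coe_of_mem]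
  exact ⟨h1, by linarith⟩

lemma abs_signedRep (a : UnitAddCircle) : |signedRep a| = ‖a‖ := by
  have h := (AddCircle.equivIoc (1 : ℝ) (-(1 / 2)) a).2
  have h' : |signedRep a| ≤ |(1 : ℝ)| / 2 := by
    rw [abs_one, abs_le]
    exact ⟨h.1.le, by linarith [h.2, show signedRep a ≤ -(1 / 2) + 1 from h.2]⟩
  conv_rhs => rw [← coe_signedRep a]
  exact ((AddCircle.norm_coe_eq_abs_iff 1 one_ne_zero).2 h').symm

lemma signedRep_sub {a b : UnitAddCircle} (ha : ‖a‖ < 1 / 4) (hb : ‖b‖ < 1 / 4) :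
    signedRep (a - b) = signedRep a - signedRep b := by
  have h : a - b = ((signedRep a - signedRep b : ℝ) : UnitAddCircle) := by
    rw [AddCircle.coe_sub, coe_signedRep, coe_signedRep]
  rw [h, signedRep_coe]
  rw [← abs_signedRep] at ha hb
  rw [abs_lt] at *
  constructor <;> linarith

/-- `φ` is a continuous lift of `f` along the side of `T` from `v k` to `v (k + 1)`, which is
parametrized by `[0, 1]`. -/
def IsSideLift {v : Fin 3 → Plane} (f : C(gasket v, UnitAddCircle)) (k : Fin 3) (φ : ℝ → ℝ) :
    Prop :=
  Continuous φ ∧ ∀ t ∈ Set.Icc (0 : ℝ) 1, ∀ x : gasket v,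
    (x : Plane) = AffineMap.lineMap (v k) (v (k + 1)) t → (φ t : UnitAddCircle) = f x

lemma IsSideLift.increment_eq {v : Fin 3 → Plane} {f : C(gasket v, UnitAddCircle)} {k : Fin 3}
    {φ ψ : ℝ → ℝ} (hφ : IsSideLift f k φ) (hψ : IsSideLift f k ψ) :
    φ 1 - φ 0 = ψ 1 - ψ 0 := by
  let D : unitInterval → ℝ := fun t => φ t - ψ t
  have hD : Continuous D :=
    (hφ.1.comp continuous_subtype_val).sub (hψ.1.comp continuous_subtype_val)
  have h0 : ∀ t : unitInterval, (D t : UnitAddCircle) = 0 := by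
    intro t
    have hx := edge_mem_gasket v k (k + 1) t.2
    simp only [D]
    rw [AddCircle.coe_sub, hφ.2 t t.2 ⟨_, hx⟩ rfl, hψ.2 t t.2 ⟨_, hx⟩ rfl, sub_self]
  have h := (AddCircle.isCoveringMap_coe (1 : ℝ)).eq_of_comp_eq hD
    (continuous_const (y := D 0)) (funext fun t => (h0 t).trans (h0 0).symm) 0 rfl
  have h1 : D 1 = D 0 := congrFun h 1
  simp only [D, Set.Icc.coe_one, Set.Icc.coe_zero] at h1
  linarith

lemma trianglePath_side (v : Fin 3 → Plane) (k : Fin 3) {t : ℝ} (ht : t ∈ Set.Icc (0 : ℝ) 1) :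
    trianglePath v ((t + (k : ℕ)) / 3) = AffineMap.lineMap (v k) (v (k + 1)) t := by
  obtain ⟨h0, h1⟩ := ht
  fin_cases k
  · rw [trianglePath_first]
    · change AffineMap.lineMap (v 0) (v 1) _ = AffineMap.lineMap (v 0) (v 1) _
      congr 1; push_cast; ring
    · constructor <;> norm_num <;> linarith
  · rw [trianglePath_second]
    · change AffineMap.lineMap (v 1) (v 2) _ = AffineMap.lineMap (v 1) (v 2) _
      congr 1; push_cast; ring
    · constructor <;> norm_num <;> linarith
  · rw [trianglePath_third]
    · change AffineMap.lineMap (v 2) (v 0) _ = AffineMap.lineMap (v 2) (v 0) _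
      congr 1; push_cast; ring
    · constructor <;> norm_num <;> linarith

lemma coe_lift {v : Fin 3 → Plane} (f : C(gasket v, UnitAddCircle)) (w : List (Fin 3))
    (t : unitInterval) : (lift f w t : UnitAddCircle) = f (loop v w t) :=
  congrFun ((AddCircle.isCoveringMap_coe (1 : ℝ)).liftPath_lifts _ _ _) t

lemma exists_isSideLift {v : Fin 3 → Plane} (f : C(gasket v, UnitAddCircle)) (k : Fin 3) :
    ∃ φ, IsSideLift f k φ ∧ φ 1 - φ 0 = sideIncrement f k := by
  refine ⟨fun t => lift f [] (Set.projIcc 0 1 zero_le_one ((t + (k : ℕ)) / 3)), ⟨?_, ?_⟩, ?_⟩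
  · exact (lift f []).continuous.comp (continuous_projIcc.comp (by fun_prop))
  · intro t ht x hx
    have hk : ((k : ℕ) : ℝ) ≤ 2 := by exact_mod_cast Nat.lt_succ_iff.1 k.2
    have hk0 : (0 : ℝ) ≤ ((k : ℕ) : ℝ) := Nat.cast_nonneg _
    have hmem : (t + (k : ℕ)) / 3 ∈ Set.Icc (0 : ℝ) 1 :=
      ⟨by linarith [ht.1], by linarith [ht.2]⟩
    rw [coe_lift, Set.projIcc_of_mem _ hmem]
    congr 1
    apply Subtype.ext
    rw [hx]
    exact trianglePath_side v k ht
  · simp only [sideIncrement, zero_add, add_comm (1 : ℝ)]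

lemma IsSideLift.sideIncrement_eq {v : Fin 3 → Plane} {f : C(gasket v, UnitAddCircle)}
    {k : Fin 3} {φ : ℝ → ℝ} (hφ : IsSideLift f k φ) : sideIncrement f k = φ 1 - φ 0 := by
  obtain ⟨ψ, hψ, h⟩ := exists_isSideLift f k
  rw [← h, hψ.increment_eq hφ]

lemma coe_sideIncrement {v : Fin 3 → Plane} (f : C(gasket v, UnitAddCircle)) (k : Fin 3) :
    (sideIncrement f k : UnitAddCircle) = f (vertex v (k + 1)) - f (vertex v k) := by
  obtain ⟨φ, hφ, h⟩ := exists_isSideLift f k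
  rw [← h, AddCircle.coe_sub, hφ.2 1 (by simp) (vertex v (k + 1)) (by simp [vertex]),
    hφ.2 0 (by simp) (vertex v k) (by simp [vertex])]

lemma sideIncrement_sub {v : Fin 3 → Plane} (f g : C(gasket v, UnitAddCircle)) (k : Fin 3) :
    sideIncrement (f - g) k = sideIncrement f k - sideIncrement g k := by
  obtain ⟨φ, hφ, h⟩ := exists_isSideLift f k
  obtain ⟨ψ, hψ, h'⟩ := exists_isSideLift g k
  have : IsSideLift (f - g) k (fun t => φ t - ψ t) :=
    ⟨hφ.1.sub hψ.1, fun t ht x hx => by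
      rw [AddCircle.coe_sub, hφ.2 t ht x hx, hψ.2 t ht x hx]; rfl⟩
  rw [this.sideIncrement_eq, ← h, ← h']
  ring

/-- The circle-valued map represented by a real-valued function. -/
noncomputable def toCircle {v : Fin 3 → Plane} (h : C(gasket v, ℝ)) :
    C(gasket v, UnitAddCircle) where
  toFun x := (h x : UnitAddCircle)
  continuous_toFun := (AddCircle.continuous_mk' 1).comp h.continuous

@[simp] lemma toCircle_apply {v : Fin 3 → Plane} (h : C(gasket v, ℝ)) (x : gasket v) :
    toCircle h x = (h x : UnitAddCircle) := rfl

lemma sideIncrement_toCircle {v : Fin 3 → Plane} (h : C(gasket v, ℝ)) (k : Fin 3) :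
    sideIncrement (toCircle h) k = h (vertex v (k + 1)) - h (vertex v k) := by
  let γ : unitInterval → gasket v := fun t =>
    ⟨AffineMap.lineMap (v k) (v (k + 1)) (t : ℝ), edge_mem_gasket v k (k + 1) t.2⟩
  have hγ : Continuous γ :=
    Continuous.subtype_mk ((AffineMap.lineMap_continuous).comp continuous_subtype_val) _
  have : IsSideLift (toCircle h) k (fun t => h (γ (Set.projIcc 0 1 zero_le_one t))) := by
    refine ⟨h.continuous.comp (hγ.comp continuous_projIcc), fun t ht x hx => ?_⟩
    simp only [Set.projIcc_of_mem _ ht, toCircle_apply]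
    congr 2
    exact Subtype.ext hx.symm
  rw [this.sideIncrement_eq]
  have h1 : γ (Set.projIcc 0 1 zero_le_one 1) = vertex v (k + 1) := by
    apply Subtype.ext; simp [γ, vertex]
  have h0 : γ (Set.projIcc 0 1 zero_le_one 0) = vertex v k := by
    apply Subtype.ext; simp [γ, vertex]
  simp only [h1, h0]

/-- The side from `v k` to `v (k + 1)` consists of the corresponding sides of the two cells with
corners `v k` and `v (k + 1)`. -/
lemma sideIncrement_eq_add {v : Fin 3 → Plane} (f : C(gasket v, UnitAddCircle)) (k : Fin 3) :
    sideIncrement f k =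
      sideIncrement (f.comp (incl v k)) k + sideIncrement (f.comp (incl v (k + 1))) k := by
  obtain ⟨φ, hφ, h⟩ := exists_isSideLift f k
  have h1 : IsSideLift (f.comp (incl v k)) k (fun t => φ (t / 2)) := by
    refine ⟨hφ.1.comp (by fun_prop), fun t ht x hx => ?_⟩
    refine hφ.2 _ ⟨by linarith [ht.1], by linarith [ht.2]⟩ _ ?_
    rw [coe_incl, hx, F_lineMap_left]
  have h2 : IsSideLift (f.comp (incl v (k + 1))) k (fun t => φ ((t + 1) / 2)) := by
    refine ⟨hφ.1.comp (by fun_prop), fun t ht x hx => ?_⟩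
    refine hφ.2 _ ⟨by linarith [ht.1], by linarith [ht.2]⟩ _ ?_
    rw [coe_incl, hx, ← AffineMap.lineMap_apply_one_sub, F_lineMap_left,
      ← AffineMap.lineMap_apply_one_sub]
    congr 1
    ring
  rw [h1.sideIncrement_eq, h2.sideIncrement_eq, ← h]
  norm_num

lemma degree_nil {v : Fin 3 → Plane} (f : C(gasket v, UnitAddCircle)) :
    degree f [] = ∑ k, sideIncrement f k := by
  rw [Fin.sum_univ_three]
  have h0 : Set.projIcc (0 : ℝ) 1 zero_le_one 0 = 0 := by simp
  have h1 : Set.projIcc (0 : ℝ) 1 zero_le_one 1 = 1 := by simp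
  simp only [sideIncrement, degree, Fin.val_zero, Fin.val_one, Fin.val_two, Nat.cast_zero,
    Nat.cast_one, Nat.cast_ofNat, zero_add, zero_div, h0]
  norm_num

lemma degree_cons {v : Fin 3 → Plane} (f : C(gasket v, UnitAddCircle)) (k : Fin 3)
    (w : List (Fin 3)) : degree f (k :: w) = degree (f.comp (incl v k)) w := rfl

lemma degree_sub {v : Fin 3 → Plane} (f g : C(gasket v, UnitAddCircle)) (w : List (Fin 3)) :
    degree (f - g) w = degree f w - degree g w := by
  induction w generalizing f g with
  | nil => simp only [degree_nil, sideIncrement_sub, Finset.sum_sub_distrib]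
  | cons k w ih => rw [degree_cons, degree_cons, degree_cons, ← ih]; rfl

lemma degree_toCircle {v : Fin 3 → Plane} (h : C(gasket v, ℝ)) (w : List (Fin 3)) :
    degree (toCircle h) w = 0 := by
  induction w generalizing h with
  | nil =>
    rw [degree_nil, Fin.sum_univ_three]
    simp only [sideIncrement_toCircle]
    change h (vertex v 1) - h (vertex v 0) + (h (vertex v 2) - h (vertex v 1)) +
      (h (vertex v 0) - h (vertex v 2)) = 0
    ring
  | cons k w ih => rw [degree_cons]; exact ih (h.comp (incl v k))

/-! ### Small cells -/

lemma exists_dist_le (v : Fin 3 → Plane) : ∃ D > 0, ∀ x y : gasket v, dist x y ≤ D := by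
  obtain ⟨C, hC⟩ := (gasket_isCompact v).isBounded.exists_norm_le
  have hC0 : 0 ≤ C := (norm_nonneg _).trans (hC _ (vertex_mem_gasket v 0))
  refine ⟨2 * C + 1, by linarith, fun x y => ?_⟩
  have : dist x y ≤ ‖(x : Plane)‖ + ‖(y : Plane)‖ := dist_le_norm_add_norm (x : Plane) y
  linarith [hC x x.2, hC y y.2]

lemma dist_incl (v : Fin 3 → Plane) (k : Fin 3) (x y : gasket v) :
    dist (incl v k x) (incl v k y) = 1 / 2 * dist x y := F_dist v k x y

/-- An induction over the cells of the gasket: a property of continuous maps holds if it holds for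
maps with small image, and for every map whose restrictions to the first-level cells have it. -/
theorem induction_of_small {X : Type*} [PseudoMetricSpace X] {v : Fin 3 → Plane}
    {P : C(gasket v, X) → Prop} {ε : ℝ} (hε : 0 < ε)
    (small : ∀ u : C(gasket v, X), (∀ x y, dist (u x) (u y) < ε) → P u)
    (step : ∀ u : C(gasket v, X), (∀ k, P (u.comp (incl v k))) → P u) (u : C(gasket v, X)) :
    P u := by
  obtain ⟨D, hD0, hD⟩ := exists_dist_le v
  have key : ∀ (n : ℕ) (u : C(gasket v, X)) (δ : ℝ),
      (∀ x y, dist x y < δ → dist (u x) (u y) < ε) → D < 2 ^ n * δ → P u := by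
    intro n
    induction n with
    | zero =>
      intro u δ hu hδ
      exact small u fun x y => hu x y (by linarith [hD x y])
    | succ n ih =>
      intro u δ hu hδ
      refine step u fun k => ih _ (2 * δ) (fun x y hxy => hu _ _ ?_) ?_
      · rw [dist_incl]; linarith
      · rw [pow_succ] at hδ; linarith
  obtain ⟨δ, hδ, hu⟩ :=
    Metric.uniformContinuous_iff.1 (CompactSpace.uniformContinuous_of_continuous u.continuous) ε hε
  obtain ⟨n, hn⟩ := pow_unbounded_of_one_lt (D / δ) (one_lt_two (α := ℝ))
  exact key n u δ (fun x y h => hu h) (by rwa [div_lt_iff₀ hδ] at hn)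

lemma exists_edges_small {X : Type*} [PseudoMetricSpace X] {v : Fin 3 → Plane}
    (hv : IsEquilateral v) (u : C(gasket v, X)) {ε : ℝ} (hε : 0 < ε) :
    ∃ M : ℕ, ∀ m ≥ M, ∀ p ∈ edges v m, dist (u p.2) (u p.1) < ε := by
  refine induction_of_small
    (P := fun u => ∃ M : ℕ, ∀ m ≥ M, ∀ p ∈ edges v m, dist (u p.2) (u p.1) < ε) hε
    (fun u hu => ⟨0, fun m _ p _ => hu _ _⟩) ?_ u
  intro u hu
  choose M hM using hu
  refine ⟨Finset.univ.sup M + 1, fun m hm p hp => ?_⟩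
  obtain ⟨m, rfl⟩ : ∃ n, m = n + 1 := ⟨m - 1, by omega⟩
  rw [edges_succ hv] at hp
  obtain ⟨k, q, hq, rfl⟩ := Set.mem_iUnion.1 hp
  have := Finset.le_sup (f := M) (Finset.mem_univ k)
  exact hM k m (by omega) q hq

/-! ### Real-valued harmonic functions -/

/-- The values at the corners of the cell `T_k` of the harmonic function with values `b` at the
corners of `T`: the value at the midpoint of a side is `2/5` of the values at the two ends of
the side plus `1/5` of the value at the opposite corner. -/
noncomputable def subBoundary (b : Fin 3 → ℝ) (k l : Fin 3) : ℝ :=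
  if l = k then b k else (b k + b l + ∑ j, b j) / 5

lemma subBoundary_self (b : Fin 3 → ℝ) (k : Fin 3) : subBoundary b k k = b k := if_pos rfl

lemma subBoundary_comm (b : Fin 3 → ℝ) (k l : Fin 3) : subBoundary b k l = subBoundary b l k := by
  unfold subBoundary
  by_cases h : l = k
  · simp [h]
  · rw [if_neg h, if_neg (Ne.symm h), add_comm (b k)]

lemma abs_subBoundary_sub_le {b : Fin 3 → ℝ} {c : ℝ} (hb : ∀ i j, |b i - b j| ≤ c)
    (k i j : Fin 3) : |subBoundary b k i - subBoundary b k j| ≤ 3 / 5 * c := by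
  have h01 := abs_le.1 (hb 0 1)
  have h02 := abs_le.1 (hb 0 2)
  have h12 := abs_le.1 (hb 1 2)
  fin_cases k <;> fin_cases i <;> fin_cases j <;>
    simp [subBoundary, Fin.sum_univ_three, abs_le] <;>
    first | linarith | (constructor <;> linarith)

/-- The affine interpolation on the gasket of values at the corners of `T`. -/
lemma exists_affine_interpolation {v : Fin 3 → Plane} (hv : IsEquilateral v) (b : Fin 3 → ℝ) :
    ∃ h : C(gasket v, ℝ), (∀ i, h (vertex v i) = b i) ∧
      ∀ c, (∀ i j, |b i - b j| ≤ c) → ∀ x i, |h x - b i| ≤ c := by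
  obtain ⟨β, hβ⟩ := exists_affineBasis hv
  have hβv : Set.range β = Set.range v := by congr 1; funext i; exact hβ i
  refine ⟨⟨fun x => ∑ j, β.coord j x * b j, ?_⟩, fun i => ?_, fun c hc x i => ?_⟩
  · refine continuous_finsetSum _ fun j _ => Continuous.mul ?_ continuous_const
    exact ((β.coord j).continuous_of_finiteDimensional).comp continuous_subtype_val
  · simp [vertex, ← hβ i, β.coord_apply]
  · have hx := gasket_subset_triangle v x.2
    rw [← hβv, β.convexHull_eq_nonneg_coord] at hx
    have hs := β.sum_coord_apply_eq_one x
    have : (∑ j, β.coord j x * b j) - b i = ∑ j, β.coord j x * (b j - b i) := by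
      simp only [mul_sub, Finset.sum_sub_distrib, ← Finset.sum_mul, hs, one_mul]
    change |(∑ j, β.coord j x * b j) - b i| ≤ c
    rw [this]
    calc _ ≤ ∑ j, |β.coord j x * (b j - b i)| := Finset.abs_sum_le_sum_abs _ _
      _ ≤ ∑ j, β.coord j x * c := by
        refine Finset.sum_le_sum fun j _ => ?_
        rw [abs_mul, abs_of_nonneg (hx j)]
        exact mul_le_mul_of_nonneg_left (hc j i) (hx j)
      _ = c := by rw [← Finset.sum_mul, hs, one_mul]

/-- The harmonic functions on the gasket: for all values at the corners there is a continuous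
function whose restriction to each first-level cell is again one of these functions, with corner
values given by the harmonic extension rule.  They are the limits of the functions that are
harmonic on the graphs `Γ_n` and affine on the cells of level `n`. -/
theorem exists_harmonicExtension {v : Fin 3 → Plane} (hv : IsEquilateral v) :
    ∃ H : (Fin 3 → ℝ) → C(gasket v, ℝ), (∀ b i, H b (vertex v i) = b i) ∧
      ∀ b k, (H b).comp (incl v k) = H (subBoundary b k) := by
  have hglue : ∀ H : {H : (Fin 3 → ℝ) → C(gasket v, ℝ) // ∀ b i, H b (vertex v i) = b i},
      ∀ b, ∃ f : C(gasket v, ℝ), ∀ k, f.comp (incl v k) = H.1 (subBoundary b k) := by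
    intro H b
    refine exists_glue hv _ fun k l => ?_
    rw [H.2, H.2, subBoundary_comm]
  choose next hnext using hglue
  have hnextv : ∀ H b i, next H b (vertex v i) = b i := by
    intro H b i
    have := DFunLike.congr_fun (hnext H b i) (vertex v i)
    rwa [H.2, subBoundary_self, ContinuousMap.comp_apply, incl_vertex_self] at this
  choose h₀ h₀v h₀c using exists_affine_interpolation hv
  let A : ℕ → {H : (Fin 3 → ℝ) → C(gasket v, ℝ) // ∀ b i, H b (vertex v i) = b i} :=
    fun n => Nat.rec ⟨h₀, h₀v⟩ (fun _ H => ⟨next H, hnextv H⟩) n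
  have hA : ∀ n b k x, (A (n + 1)).1 b (incl v k x) = (A n).1 (subBoundary b k) x :=
    fun n b k x => DFunLike.congr_fun (hnext (A n) b k) x
  have hdist : ∀ n b c, (∀ i j, |b i - b j| ≤ c) → ∀ x,
      |(A n).1 b x - (A (n + 1)).1 b x| ≤ 2 * c * (3 / 5) ^ n := by
    intro n
    induction n with
    | zero =>
      intro b c hc x
      obtain ⟨k, y, rfl⟩ := exists_incl_eq x
      have h1 : |(A 0).1 b (incl v k y) - b k| ≤ c := h₀c b c hc _ k
      have h2 : |(A 1).1 b (incl v k y) - b k| ≤ 3 / 5 * c := by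
        rw [show (A 1).1 b (incl v k y) = _ from hA 0 b k y]
        have := h₀c _ _ (abs_subBoundary_sub_le hc k) y k
        rwa [subBoundary_self] at this
      have hc0 : 0 ≤ c := (abs_nonneg _).trans h1
      rw [abs_le] at *
      constructor <;> simp only [zero_add, pow_zero] <;> linarith
    | succ n ih =>
      intro b c hc x
      obtain ⟨k, y, rfl⟩ := exists_incl_eq x
      rw [hA n b k y, hA (n + 1) b k y]
      refine (ih _ _ (abs_subBoundary_sub_le hc k) y).trans (le_of_eq ?_)
      ring
  have hlim : ∀ b, ∃ h : C(gasket v, ℝ),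
      Filter.Tendsto (fun n => (A n).1 b) Filter.atTop (nhds h) := by
    intro b
    refine cauchySeq_tendsto_of_complete ?_
    let c := ∑ i, ∑ j, |b i - b j|
    have hc : ∀ i j, |b i - b j| ≤ c := by
      intro i j
      calc |b i - b j| ≤ ∑ j, |b i - b j| :=
            Finset.single_le_sum (f := fun j => |b i - b j|) (fun _ _ => abs_nonneg _)
              (Finset.mem_univ j)
        _ ≤ c := Finset.single_le_sum (f := fun i => ∑ j, |b i - b j|)
            (fun _ _ => Finset.sum_nonneg fun _ _ => abs_nonneg _) (Finset.mem_univ i)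
    have hc0 : 0 ≤ c := (abs_nonneg _).trans (hc 0 0)
    refine cauchySeq_of_le_geometric (3 / 5) (2 * c) (by norm_num) fun n => ?_
    rw [ContinuousMap.dist_le (by positivity)]
    exact fun x => hdist n b c hc x
  choose H hH using hlim
  have hHx : ∀ b x, Filter.Tendsto (fun n => (A n).1 b x) Filter.atTop (nhds (H b x)) :=
    fun b x => ((ContinuousEvalConst.continuous_eval_const x).tendsto _).comp (hH b)
  refine ⟨H, fun b i => ?_, fun b k => ?_⟩
  · refine tendsto_nhds_unique (hHx b _) ?_
    simp only [(A _).2]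
    exact tendsto_const_nhds
  · ext x
    refine tendsto_nhds_unique ((hHx b (incl v k x)).comp (Filter.tendsto_add_atTop_nat 1)) ?_
    simpa only [Function.comp_def, hA] using hHx (subBoundary b k) x

lemma starSum_zero {v : Fin 3 → Plane} (hv : IsEquilateral v) (φ : gasket v × gasket v → ℝ)
    (i : Fin 3) :
    starSum v 0 φ (vertex v i) = ∑ j, if i = j then 0 else φ (vertex v i, vertex v j) := by
  unfold starSum
  rw [edgeSum_zero hv, Finset.sum_eq_single i]
  · simp
  · intro k _ hk
    refine Finset.sum_eq_zero fun j _ => ?_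
    rw [if_neg fun h => hk (vertex_injective hv h), ite_self]
  · simp

/-- The difference of the values of `h` at the two ends of an edge. -/
def diff {v : Fin 3 → Plane} (h : C(gasket v, ℝ)) (p : gasket v × gasket v) : ℝ := h p.2 - h p.1

lemma diff_comp_map {v : Fin 3 → Plane} (h : C(gasket v, ℝ)) (k : Fin 3) :
    diff h ∘ Prod.map (incl v k) (incl v k) = diff (h.comp (incl v k)) := rfl

lemma starSum_harmonicExtension_vertex {v : Fin 3 → Plane} (hv : IsEquilateral v)
    {H : (Fin 3 → ℝ) → C(gasket v, ℝ)} (hHv : ∀ b i, H b (vertex v i) = b i)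
    (hHs : ∀ b k, (H b).comp (incl v k) = H (subBoundary b k)) (m : ℕ) (b : Fin 3 → ℝ)
    (i : Fin 3) :
    starSum v m (diff (H b)) (vertex v i) = (3 / 5) ^ m * ((∑ j, b j) - 3 * b i) := by
  induction m generalizing b with
  | zero =>
    rw [starSum_zero hv]
    simp only [diff, hHv]
    fin_cases i <;> simp [Fin.sum_univ_three] <;> ring
  | succ m ih =>
    rw [starSum_vertex hv, diff_comp_map, hHs, ih]
    fin_cases i <;> simp [subBoundary, Fin.sum_univ_three] <;> ring

lemma starSum_harmonicExtension {v : Fin 3 → Plane} (hv : IsEquilateral v)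
    {H : (Fin 3 → ℝ) → C(gasket v, ℝ)} (hHv : ∀ b i, H b (vertex v i) = b i)
    (hHs : ∀ b k, (H b).comp (incl v k) = H (subBoundary b k)) (m : ℕ) (b : Fin 3 → ℝ)
    (x : gasket v) (hx : (x : Plane) ∈ vertexSet v m \ vertexSet v 0) :
    starSum v m (diff (H b)) x = 0 := by
  induction m generalizing b x with
  | zero => exact absurd hx.1 hx.2
  | succ m ih =>
    obtain ⟨k, l, hkl, rfl⟩ | ⟨k, y, hy, rfl⟩ := vertexSet_succ_cases hx
    · rw [starSum_junction hv m _ hkl, diff_comp_map, diff_comp_map, hHs, hHs,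
        starSum_harmonicExtension_vertex hv hHv hHs, starSum_harmonicExtension_vertex hv hHv hHs,
        ← mul_add]
      refine mul_eq_zero_of_right _ ?_
      fin_cases k <;> fin_cases l <;> first | exact absurd rfl hkl | skip
      all_goals simp [subBoundary, Fin.sum_univ_three]; ring
    · rw [starSum_incl hv m _ k y fun l _ => ne_vertex_of_notMem hy.2 l, diff_comp_map, hHs]
      exact ih _ _ hy

/-- At fine levels the circle-valued Laplacian of a map represented by a real-valued function is
the real-valued Laplacian. -/
lemma exists_discreteLaplacian_toCircle {v : Fin 3 → Plane} (hv : IsEquilateral v)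
    (h : C(gasket v, ℝ)) :
    ∃ M : ℕ, ∀ m ≥ M, ∀ x, discreteLaplacian m (toCircle h) x = starSum v m (diff h) x := by
  obtain ⟨M, hM⟩ := exists_edges_small hv h (ε := 1 / 2) (by norm_num)
  refine ⟨M, fun m hm x => ?_⟩
  rw [discreteLaplacian_eq_starSum]
  refine edgeSum_congr fun p hp => ?_
  have : signedRep (toCircle h p.2 - toCircle h p.1) = diff h p := by
    rw [toCircle_apply, toCircle_apply, ← AddCircle.coe_sub, signedRep_coe (hM m hm p hp)]
    rfl
  simp only [this]

/-! ### Existence -/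

lemma discreteLaplacian_incl {v : Fin 3 → Plane} (hv : IsEquilateral v) (m : ℕ)
    (f : C(gasket v, UnitAddCircle)) (k : Fin 3) {x : gasket v}
    (hx : (x : Plane) ∉ vertexSet v 0) :
    discreteLaplacian (m + 1) f (incl v k x) = discreteLaplacian m (f.comp (incl v k)) x := by
  rw [discreteLaplacian_eq_starSum, discreteLaplacian_eq_starSum,
    starSum_incl hv m _ k x fun l _ => ne_vertex_of_notMem hx l]
  rfl

lemma discreteLaplacian_vertex {v : Fin 3 → Plane} (hv : IsEquilateral v) (m : ℕ)
    (f : C(gasket v, UnitAddCircle)) (k : Fin 3) :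
    discreteLaplacian (m + 1) f (vertex v k) =
      discreteLaplacian m (f.comp (incl v k)) (vertex v k) := by
  rw [discreteLaplacian_eq_starSum, discreteLaplacian_eq_starSum, starSum_vertex hv]
  rfl

lemma discreteLaplacian_junction {v : Fin 3 → Plane} (hv : IsEquilateral v) (m : ℕ)
    (f : C(gasket v, UnitAddCircle)) {k l : Fin 3} (hkl : k ≠ l) :
    discreteLaplacian (m + 1) f (incl v k (vertex v l)) =
      discreteLaplacian m (f.comp (incl v k)) (vertex v l) +
      discreteLaplacian m (f.comp (incl v l)) (vertex v k) := by
  rw [discreteLaplacian_eq_starSum, discreteLaplacian_eq_starSum, discreteLaplacian_eq_starSum,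
    starSum_junction hv m _ hkl]
  rfl

/-- At all fine levels `m` the discrete Laplacian of `f` vanishes at the interior nodes, and at
the corner `v i` it is `(3/5)^m ν i`: the number `ν i` is the normal derivative of `f` at `v i`. -/
def EventuallyHarmonic {v : Fin 3 → Plane} (f : C(gasket v, UnitAddCircle)) (ν : Fin 3 → ℝ) :
    Prop :=
  ∃ M : ℕ, ∀ m ≥ M,
    (∀ x : gasket v, (x : Plane) ∈ vertexSet v m \ vertexSet v 0 → discreteLaplacian m f x = 0) ∧
    ∀ i, discreteLaplacian m f (vertex v i) = (3 / 5) ^ m * ν i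

lemma EventuallyHarmonic.isHarmonicMap {v : Fin 3 → Plane} {f : C(gasket v, UnitAddCircle)}
    {ν : Fin 3 → ℝ} (h : EventuallyHarmonic f ν) : IsHarmonicMap f := by
  obtain ⟨M, hM⟩ := h
  refine ⟨continuous_zero, fun ε hε => ⟨M, fun m hm x hx => ?_⟩⟩
  rw [(hM m hm).1 x hx]
  simpa using hε

/-- Maps that are harmonic on the three first-level cells form a harmonic map if their normal
derivatives cancel at the junction points. -/
lemma EventuallyHarmonic.of_comp_incl {v : Fin 3 → Plane} (hv : IsEquilateral v)
    {f : C(gasket v, UnitAddCircle)} {ν : Fin 3 → Fin 3 → ℝ}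
    (h : ∀ k, EventuallyHarmonic (f.comp (incl v k)) (ν k))
    (hν : ∀ k l, k ≠ l → ν k l + ν l k = 0) :
    EventuallyHarmonic f fun k => 5 / 3 * ν k k := by
  choose M hM using h
  refine ⟨Finset.univ.sup M + 1, fun m hm => ?_⟩
  obtain ⟨m, rfl⟩ : ∃ n, m = n + 1 := ⟨m - 1, by omega⟩
  have hm' : ∀ k, m ≥ M k := fun k => by
    have := Finset.le_sup (f := M) (Finset.mem_univ k)
    omega
  refine ⟨fun x hx => ?_, fun k => ?_⟩
  · obtain ⟨k, l, hkl, rfl⟩ | ⟨k, y, hy, rfl⟩ := vertexSet_succ_cases hx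
    · rw [discreteLaplacian_junction hv m f hkl, (hM k m (hm' k)).2, (hM l m (hm' l)).2,
        ← mul_add, hν k l hkl, mul_zero]
    · rw [discreteLaplacian_incl hv m f k hy.2, (hM k m (hm' k)).1 y hy]
  · rw [discreteLaplacian_vertex hv, (hM k m (hm' k)).2]
    ring

/-- A harmonic map without degrees is represented by a real-valued harmonic function. -/
lemma exists_harmonicMap_of_degree_zero {v : Fin 3 → Plane} (hv : IsEquilateral v)
    (d : Fin 3 → ℝ) (hd : ∑ k, d k = 0) (a : UnitAddCircle) :
    ∃ f : C(gasket v, UnitAddCircle), f (vertex v 0) = a ∧ (∀ k, sideIncrement f k = d k) ∧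
      (∀ w, degree f w = 0) ∧ EventuallyHarmonic f fun i => d i - d (i + 2) := by
  obtain ⟨H, hHv, hHs⟩ := exists_harmonicExtension hv
  obtain ⟨M, hM⟩ := exists_discreteLaplacian_toCircle hv
    (H ![signedRep a, signedRep a + d 0, signedRep a + d 0 + d 1])
  rw [Fin.sum_univ_three] at hd
  refine ⟨toCircle (H ![signedRep a, signedRep a + d 0, signedRep a + d 0 + d 1]), ?_,
    fun k => ?_, degree_toCircle _, M, fun m hm => ⟨fun x hx => ?_, fun i => ?_⟩⟩
  · rw [toCircle_apply, hHv]
    exact coe_signedRep a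
  · rw [sideIncrement_toCircle, hHv, hHv]
    fin_cases k <;> simp
    linarith
  · rw [hM m hm, starSum_harmonicExtension hv hHv hHs m _ x hx]
  · rw [hM m hm, starSum_harmonicExtension_vertex hv hHv hHs]
    congr 1
    fin_cases i <;> simp [Fin.sum_univ_three] <;> linarith

/-- The harmonic maps with prescribed degrees `ρ w`, where `ρ w = 0` for words of length at
least `N`.  Their normal derivatives at the corners depend on the increments `d` along the sides
of `T` as for real-valued harmonic functions, up to a shift `κ` that depends only on `ρ`. -/
theorem exists_eventuallyHarmonic {v : Fin 3 → Plane} (hv : IsEquilateral v) (N : ℕ)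
    (ρ : List (Fin 3) → ℤ) (hρ : ∀ w, N ≤ w.length → ρ w = 0) :
    ∃ κ : Fin 3 → ℝ, ∀ d : Fin 3 → ℝ, ∑ k, d k = ρ [] → ∀ a : UnitAddCircle,
      ∃ f : C(gasket v, UnitAddCircle), f (vertex v 0) = a ∧ (∀ k, sideIncrement f k = d k) ∧
        (∀ w, degree f w = ρ w) ∧ EventuallyHarmonic f fun i => κ i + (d i - d (i + 2)) := by
  induction N generalizing ρ with
  | zero =>
    refine ⟨0, fun d hd a => ?_⟩
    rw [hρ [] le_rfl, Int.cast_zero] at hd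
    obtain ⟨f, h1, h2, h3, h4⟩ := exists_harmonicMap_of_degree_zero hv d hd a
    refine ⟨f, h1, h2, fun w => ?_, ?_⟩
    · rw [h3, hρ w (Nat.zero_le _), Int.cast_zero]
    · simpa using h4
  | succ N ih =>
    choose κ hκ using fun k : Fin 3 =>
      ih (fun w => ρ (k :: w)) fun w hw => hρ _ (by simpa using hw)
    -- The midpoint of the side from `v k` to `v (k + 1)` splits the increment `d k` into
    -- `d k / 2 + s k` and `d k / 2 - s k`.  Cancellation of the normal derivatives there reads
    -- `5 * s k = ∑ j, s j + β k + (d (k + 1) - d (k + 2)) / 2`.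
    let β : Fin 3 → ℝ := fun k => κ k (k + 1) + κ (k + 1) k + ρ [k] - ρ [k + 1]
    refine ⟨fun k => 5 / 3 * (κ k k + (β k + β (k + 2) + ∑ j, β j) / 5), fun d hd a => ?_⟩
    let B : Fin 3 → ℝ := fun k => β k + (d (k + 1) - d (k + 2)) / 2
    let s : Fin 3 → ℝ := fun k => (B k + (∑ j, B j) / 2) / 5
    let p : Fin 3 → ℝ := fun k => d k / 2 + s k
    let q : Fin 3 → ℝ := fun k => d (k + 2) / 2 - s (k + 2)
    let e : Fin 3 → Fin 3 → ℝ := fun k l =>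
      if l = k then p k else if l = k + 2 then q k else ρ [k] - p k - q k
    have hsum : ∀ k, ∑ l, e k l = ρ [k] := by
      intro k
      fin_cases k <;> simp [e, Fin.sum_univ_three] <;> ring
    have hpq : ∀ k, p k + q (k + 1) = d k := by
      intro k
      have : k + 1 + 2 = k := by fin_cases k <;> rfl
      simp only [p, q, this]
      ring
    let a' : Fin 3 → UnitAddCircle := ![a, a + (e 0 0 : ℝ), a - (e 0 2 : ℝ)]
    choose g hg0 hgs hgd hgh using fun k => hκ k (e k) (hsum k) (a' k)
    have hside : ∀ k l, g k (vertex v (l + 1)) = g k (vertex v l) + (e k l : ℝ) := by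
      intro k l
      rw [← hgs, coe_sideIncrement]
      abel
    have h01 : g 0 (vertex v 1) = g 1 (vertex v 0) := by
      rw [hg0 1]
      exact (hside 0 0).trans (by rw [hg0 0]; rfl)
    have h02 : g 0 (vertex v 2) = g 2 (vertex v 0) := by
      rw [hg0 2]
      have : g 0 (vertex v 0) = g 0 (vertex v 2) + (e 0 2 : ℝ) := hside 0 2
      rw [hg0 0] at this
      exact eq_sub_of_add_eq this.symm
    have h12 : g 1 (vertex v 2) = g 2 (vertex v 1) := by
      have h1 : g 1 (vertex v 0) = g 1 (vertex v 2) + (e 1 2 : ℝ) := hside 1 2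
      have h2 : g 2 (vertex v 1) = g 2 (vertex v 0) + (e 2 0 : ℝ) := hside 2 0
      rw [hg0 1] at h1
      rw [hg0 2] at h2
      change a + (e 0 0 : ℝ) = _ at h1
      change _ = a - (e 0 2 : ℝ) + _ at h2
      -- The degree around the hole of `T` is an integer.
      have h_int : e 0 0 + e 0 2 - e 1 2 - e 2 0 = ((ρ [] - ρ [1] - ρ [2] : ℤ) : ℝ) := by
        have hp0 := hpq 0
        have hp1 := hpq 1
        have hp2 := hpq 2
        rw [Fin.sum_univ_three, ← hp0, ← hp1, ← hp2] at hd
        simp [e] at hd ⊢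
        linarith
      have hz : ((e 0 0 + e 0 2 - e 1 2 - e 2 0 : ℝ) : UnitAddCircle) = 0 := by
        rw [h_int, AddCircle.coe_eq_zero_iff]
        exact ⟨_, by rw [zsmul_eq_mul, mul_one]⟩
      rw [AddCircle.coe_sub, AddCircle.coe_sub, AddCircle.coe_add] at hz
      rw [h2, eq_sub_of_add_eq h1.symm, ← sub_eq_zero, ← hz]
      abel
    obtain ⟨f, hf⟩ := exists_glue hv g fun k l => by
      fin_cases k <;> fin_cases l <;>
        first | rfl | exact h01 | exact h02 | exact h12 | exact h01.symm | exact h02.symm |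
          exact h12.symm
    refine ⟨f, ?_, ?_, ?_, ?_⟩
    · rw [← incl_vertex_self]
      exact (DFunLike.congr_fun (hf 0) (vertex v 0)).trans (hg0 0)
    · intro k
      rw [sideIncrement_eq_add, hf, hf, hgs, hgs, ← hpq k]
      fin_cases k <;> simp [e]
    · intro w
      cases w with
      | nil =>
        rw [degree_nil, ← hd]
        refine Finset.sum_congr rfl fun k _ => ?_
        rw [sideIncrement_eq_add, hf, hf, hgs, hgs, ← hpq k]
        fin_cases k <;> simp [e]
      | cons k w => rw [degree_cons, hf, hgd]
    · have hh := EventuallyHarmonic.of_comp_incl hv (f := f)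
        (ν := fun k i => κ k i + (e k i - e k (i + 2)))
        (fun k => by rw [hf]; exact hgh k) ?_
      · convert hh using 2 with k
        fin_cases k <;> simp [e, p, q, s, B, Fin.sum_univ_three] <;> ring
      · intro k l hkl
        fin_cases k <;> fin_cases l <;> first | exact absurd rfl hkl | skip
        all_goals simp [e, p, q, s, B, β, Fin.sum_univ_three]; ring

/-! ### Uniqueness -/

/-- A map all of whose degrees vanish is represented by a real-valued function.  This is clear for
maps with small image; representatives on the three first-level cells can be shifted so that they
match at two of the junction points, and they match at the third one because the degree on the
boundary of `T` vanishes. -/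
theorem exists_toCircle_eq {v : Fin 3 → Plane} (hv : IsEquilateral v)
    (u : C(gasket v, UnitAddCircle)) (hu : ∀ w, degree u w = 0) :
    ∃ h : C(gasket v, ℝ), toCircle h = u := by
  revert hu
  refine induction_of_small
    (P := fun u => (∀ w, degree u w = 0) → ∃ h : C(gasket v, ℝ), toCircle h = u)
    (ε := 1 / 4) (by norm_num) ?_ ?_ u
  · intro u hu _
    have hd : ∀ x y, dist (signedRep (u x - u (vertex v 0))) (signedRep (u y - u (vertex v 0))) =
        dist (u x) (u y) := by
      intro x y
      have hsmall : ∀ x, ‖u x - u (vertex v 0)‖ < 1 / 4 := fun x => by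
        rw [← dist_eq_norm]; exact hu _ _
      rw [Real.dist_eq, ← signedRep_sub (hsmall x) (hsmall y), abs_signedRep, sub_sub_sub_cancel_right,
        dist_eq_norm]
    have hc : Continuous fun x => signedRep (u x - u (vertex v 0)) := by
      rw [Metric.continuous_iff]
      simp only [hd]
      exact Metric.continuous_iff.1 u.continuous
    refine ⟨⟨fun x => signedRep (u x - u (vertex v 0)) + signedRep (u (vertex v 0)),
      hc.add continuous_const⟩, ?_⟩
    ext x
    change ((signedRep _ + signedRep _ : ℝ) : UnitAddCircle) = u x
    rw [AddCircle.coe_add, coe_signedRep, coe_signedRep, sub_add_cancel]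
  · intro u ih hu
    choose h hh using fun k => ih k fun w => hu (k :: w)
    have hx : ∀ k x, (h k x : UnitAddCircle) = u (incl v k x) := fun k x =>
      DFunLike.congr_fun (hh k) x
    let c : Fin 3 → ℝ :=
      ![0, h 0 (vertex v 1) - h 1 (vertex v 0), h 0 (vertex v 2) - h 2 (vertex v 0)]
    have hc : ∀ k, (c k : UnitAddCircle) = 0 := by
      intro k
      fin_cases k
      · rfl
      · change ((h 0 (vertex v 1) - h 1 (vertex v 0) : ℝ) : UnitAddCircle) = 0
        rw [AddCircle.coe_sub, hx, hx, incl_vertex_comm, sub_self]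
      · change ((h 0 (vertex v 2) - h 2 (vertex v 0) : ℝ) : UnitAddCircle) = 0
        rw [AddCircle.coe_sub, hx, hx, incl_vertex_comm, sub_self]
    have hdeg := hu []
    rw [degree_nil, Fin.sum_univ_three] at hdeg
    have hside : ∀ k, sideIncrement u k = h k (vertex v (k + 1)) - h k (vertex v k) +
        (h (k + 1) (vertex v (k + 1)) - h (k + 1) (vertex v k)) := fun k => by
      rw [sideIncrement_eq_add, ← hh, ← hh, sideIncrement_toCircle, sideIncrement_toCircle]
    rw [hside, hside, hside] at hdeg
    have h12 : h 1 (vertex v 2) + c 1 = h 2 (vertex v 1) + c 2 := by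
      simp [c] at hdeg ⊢
      linarith
    obtain ⟨f, hf⟩ := exists_glue hv (fun k => h k + ContinuousMap.const _ (c k)) fun k l => by
      have e01 : h 0 (vertex v 1) + c 0 = h 1 (vertex v 0) + c 1 := by simp [c]
      have e02 : h 0 (vertex v 2) + c 0 = h 2 (vertex v 0) + c 2 := by simp [c]
      fin_cases k <;> fin_cases l <;>
        first | rfl | exact e01 | exact e02 | exact h12 | exact e01.symm | exact e02.symm |
          exact h12.symm
    refine ⟨f, ?_⟩
    ext x
    obtain ⟨k, y, rfl⟩ := exists_incl_eq x
    have : f (incl v k y) = h k y + c k := DFunLike.congr_fun (hf k) y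
    rw [toCircle_apply, this, AddCircle.coe_add, hc, add_zero, hx]

/-- The graph energy of `h` at level `m`, with every edge counted twice. -/
noncomputable def energy {v : Fin 3 → Plane} (m : ℕ) (h : C(gasket v, ℝ)) : ℝ :=
  edgeSum v m fun p => diff h p ^ 2

lemma energy_succ {v : Fin 3 → Plane} (hv : IsEquilateral v) (m : ℕ) (h : C(gasket v, ℝ)) :
    energy (m + 1) h = ∑ k, energy m (h.comp (incl v k)) := edgeSum_succ hv m _

/-- The renormalized energies `(5/3)^m * energy m h` increase with `m`. -/
lemma energy_le_energy_succ {v : Fin 3 → Plane} (hv : IsEquilateral v) (m : ℕ)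
    (h : C(gasket v, ℝ)) : 3 / 5 * energy m h ≤ energy (m + 1) h := by
  induction m generalizing h with
  | zero =>
    rw [energy_succ hv]
    simp only [energy, edgeSum_zero hv, diff, Fin.sum_univ_three, ContinuousMap.comp_apply,
      incl_vertex_self]
    rw [incl_vertex_comm v 1 0, incl_vertex_comm v 2 0, incl_vertex_comm v 2 1]
    simp
    set b₀ := h (vertex v 0)
    set b₁ := h (vertex v 1)
    set b₂ := h (vertex v 2)
    set x := h (incl v 0 (vertex v 1))
    set y := h (incl v 0 (vertex v 2))
    set z := h (incl v 1 (vertex v 2))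
    -- The difference of the two sides is a quadratic form in the deviations of `x`, `y`, `z`
    -- from the values of the harmonic extension.
    linarith [sq_nonneg (x - (2 * b₀ + 2 * b₁ + b₂) / 5),
      sq_nonneg (y - (2 * b₀ + 2 * b₂ + b₁) / 5), sq_nonneg (z - (2 * b₁ + 2 * b₂ + b₀) / 5),
      sq_nonneg ((x - (2 * b₀ + 2 * b₁ + b₂) / 5) - (y - (2 * b₀ + 2 * b₂ + b₁) / 5)),
      sq_nonneg ((x - (2 * b₀ + 2 * b₁ + b₂) / 5) - (z - (2 * b₁ + 2 * b₂ + b₀) / 5)),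
      sq_nonneg ((y - (2 * b₀ + 2 * b₂ + b₁) / 5) - (z - (2 * b₁ + 2 * b₂ + b₀) / 5))]
  | succ m ih =>
    rw [energy_succ hv, energy_succ hv, Finset.mul_sum]
    exact Finset.sum_le_sum fun k _ => ih _

/-- Summation by parts. -/
lemma energy_eq {v : Fin 3 → Plane} (m : ℕ) (h : C(gasket v, ℝ)) :
    energy m h = -2 * edgeSum v m fun p => h p.1 * diff h p := by
  have h1 : edgeSum v m (fun p => h p.1 * diff h p) =
      edgeSum v m fun p => -(h p.2 * diff h p) := by
    rw [← edgeSum_swap]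
    refine edgeSum_congr fun p _ => ?_
    simp only [diff, Prod.fst_swap, Prod.snd_swap]
    ring
  have h2 := edgeSum_add (v := v) (m := m) (fun p => diff h p ^ 2) fun p => h p.1 * diff h p
  have h3 : edgeSum v m (fun p => diff h p ^ 2 + h p.1 * diff h p) =
      -1 * edgeSum v m fun p => h p.1 * diff h p := by
    rw [h1, ← edgeSum_const_mul]
    refine edgeSum_congr fun p _ => ?_
    simp only [diff]
    ring
  rw [h3] at h2
  rw [energy]
  linarith

lemma edgeSum_one {v : Fin 3 → Plane} (hv : IsEquilateral v) (m : ℕ) :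
    edgeSum v m (fun _ => 1) = 6 * 3 ^ m := by
  induction m with
  | zero =>
    rw [edgeSum_zero hv]
    simp [Fin.sum_univ_three]
    norm_num
  | succ m ih =>
    rw [edgeSum_succ hv]
    simp only [Function.comp_def, ih, Finset.sum_const, Finset.card_univ, Fintype.card_fin]
    simp
    ring

/-- If `h` vanishes at the corners, its energy is controlled by its Laplacian at the interior
nodes. -/
lemma energy_le_of_laplacian_le {v : Fin 3 → Plane} (hv : IsEquilateral v) (m : ℕ)
    (h : C(gasket v, ℝ)) {C η : ℝ} (hη : 0 ≤ η) (hC : ∀ x, |h x| ≤ C)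
    (h0 : ∀ i, h (vertex v i) = 0)
    (hL : ∀ x : gasket v, (x : Plane) ∈ vertexSet v m \ vertexSet v 0 →
      |starSum v m (diff h) x| ≤ η) :
    energy m h ≤ 12 * C * η * 3 ^ m := by
  classical
  have hC0 : 0 ≤ C := (abs_nonneg _).trans (hC (vertex v 0))
  let E := (edges_finite v m).toFinset
  have hE : ∀ φ, edgeSum v m φ = ∑ p ∈ E, φ p := fun φ =>
    finsum_mem_eq_finite_toFinset_sum _ _
  have hgroup : edgeSum v m (fun p => h p.1 * diff h p) =
      ∑ x ∈ E.image Prod.fst, h x * starSum v m (diff h) x := by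
    rw [hE, ← Finset.sum_fiberwise_of_maps_to (s := E) (t := E.image Prod.fst) (g := Prod.fst)
      fun p hp => Finset.mem_image_of_mem _ hp]
    refine Finset.sum_congr rfl fun x _ => ?_
    rw [starSum, hE, ← Finset.sum_filter, Finset.mul_sum]
    refine Finset.sum_congr (by congr) fun p hp => ?_
    rw [(Finset.mem_filter.1 hp).2]
  have hterm : ∀ x ∈ E.image Prod.fst, |h x * starSum v m (diff h) x| ≤ C * η := by
    intro x hx
    obtain ⟨p, hp, rfl⟩ := Finset.mem_image.1 hx
    have hp' : p ∈ edges v m := (edges_finite v m).mem_toFinset.1 hp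
    by_cases hb : (p.1 : Plane) ∈ vertexSet v 0
    · obtain ⟨i, hi⟩ := mem_vertexSet_zero.1 hb
      have : p.1 = vertex v i := Subtype.ext hi
      rw [this, h0, zero_mul, abs_zero]
      positivity
    · rw [abs_mul]
      exact mul_le_mul (hC _) (hL _ ⟨hp'.2.1, hb⟩) (abs_nonneg _) hC0
  have hcard : ((E.image Prod.fst).card : ℝ) ≤ 6 * 3 ^ m := by
    rw [← edgeSum_one hv m, hE, Finset.sum_const, nsmul_eq_mul, mul_one]
    exact_mod_cast Finset.card_image_le
  have hbound : |edgeSum v m (fun p => h p.1 * diff h p)| ≤ 6 * 3 ^ m * (C * η) := by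
    rw [hgroup]
    calc _ ≤ ∑ x ∈ E.image Prod.fst, |h x * starSum v m (diff h) x| :=
          Finset.abs_sum_le_sum_abs _ _
      _ ≤ ∑ x ∈ E.image Prod.fst, C * η := Finset.sum_le_sum hterm
      _ = (E.image Prod.fst).card * (C * η) := by rw [Finset.sum_const, nsmul_eq_mul]
      _ ≤ 6 * 3 ^ m * (C * η) := mul_le_mul_of_nonneg_right hcard (by positivity)
  rw [energy_eq]
  linarith [(abs_le.1 hbound).1]

lemma energy_nonneg {v : Fin 3 → Plane} (m : ℕ) (h : C(gasket v, ℝ)) : 0 ≤ energy m h :=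
  finsum_nonneg fun _ => finsum_nonneg fun _ => sq_nonneg _

lemma diff_eq_zero_of_energy_eq_zero {v : Fin 3 → Plane} {m : ℕ} {h : C(gasket v, ℝ)}
    (hE : energy m h = 0) {p : gasket v × gasket v} (hp : p ∈ edges v m) : diff h p = 0 := by
  rw [energy, edgeSum, finsum_mem_eq_finite_toFinset_sum _ (edges_finite v m),
    Finset.sum_eq_zero_iff_of_nonneg fun _ _ => sq_nonneg _] at hE
  exact pow_eq_zero_iff two_ne_zero |>.1 (hE p ((edges_finite v m).mem_toFinset.2 hp))

/-- A continuous function without increments along edges is constant. -/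
lemma eq_const_of_diff_eq_zero {v : Fin 3 → Plane} (hv : IsEquilateral v) (h : C(gasket v, ℝ))
    (hh : ∀ m, ∀ p ∈ edges v m, diff h p = 0) (x : gasket v) : h x = h (vertex v 0) := by
  refine eq_of_forall_dist_le fun ε hε => ?_
  revert hh x
  refine induction_of_small
    (P := fun h => (∀ m, ∀ p ∈ edges v m, diff h p = 0) → ∀ x, dist (h x) (h (vertex v 0)) ≤ ε)
    hε (fun u hu _ x => (hu _ _).le) ?_ h
  intro u ih hu x
  obtain ⟨k, y, rfl⟩ := exists_incl_eq x
  have hk : ∀ m, ∀ p ∈ edges v m, diff (u.comp (incl v k)) p = 0 := by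
    intro m p hp
    refine hu (m + 1) (Prod.map (incl v k) (incl v k) p) ?_
    rw [edges_succ hv]
    exact Set.mem_iUnion.2 ⟨k, p, hp, rfl⟩
  have hvert : ∀ u : C(gasket v, ℝ), (∀ m, ∀ p ∈ edges v m, diff u p = 0) → ∀ i j,
      u (vertex v i) = u (vertex v j) := by
    intro u hu i j
    by_cases hij : i = j
    · rw [hij]
    · refine (sub_eq_zero.1 (hu 0 (vertex v i, vertex v j) ?_)).symm
      rw [edges_zero]
      exact ⟨i, j, fun h => hij (vertices_injective hv h), rfl⟩
  have h0 : u (incl v k (vertex v 0)) = u (vertex v 0) := by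
    rw [show u (incl v k (vertex v 0)) = u (incl v k (vertex v k)) from hvert _ hk 0 k,
      incl_vertex_self, hvert u hu k 0]
  rw [← h0]
  exact ih k hk y

/-- A function that vanishes at the corners and has Laplacian zero vanishes. -/
theorem eq_zero_of_laplacian_tendsto_zero {v : Fin 3 → Plane} (hv : IsEquilateral v)
    (h : C(gasket v, ℝ)) (h0 : ∀ i, h (vertex v i) = 0)
    (hL : ∀ ε > 0, ∃ M : ℕ, ∀ m ≥ M, ∀ x : gasket v, (x : Plane) ∈ vertexSet v m \ vertexSet v 0 →
      5 ^ m * |starSum v m (diff h) x| ≤ ε) (x : gasket v) : h x = 0 := by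
  have hC : ∀ x, |h x| ≤ ‖h‖ := fun x => h.norm_coe_le_norm x
  have hmono : ∀ n j, (3 / 5) ^ j * energy n h ≤ energy (n + j) h := by
    intro n j
    induction j with
    | zero => simp
    | succ j ih =>
      have := energy_le_energy_succ hv (n + j) h
      rw [← add_assoc, pow_succ]
      linarith
  have hE : ∀ n, energy n h = 0 := by
    intro n
    refine le_antisymm (le_of_forall_pos_le_add fun ε hε => ?_) (energy_nonneg n h)
    have hpos : 0 < 12 * ‖h‖ + 1 := by positivity
    obtain ⟨M, hM⟩ := hL (ε / (12 * ‖h‖ + 1)) (by positivity)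
    have h5 : (0 : ℝ) < 5 ^ (n + M) := by positivity
    have h1 := energy_le_of_laplacian_le hv (n + M) h
      (η := ε / (12 * ‖h‖ + 1) / 5 ^ (n + M)) (by positivity) hC h0 fun x hx => by
        rw [le_div_iff₀ h5, mul_comm]
        exact hM (n + M) (by omega) x hx
    have h2 := (hmono n M).trans h1
    have h3 : 12 * ‖h‖ * (ε / (12 * ‖h‖ + 1) / 5 ^ (n + M)) * 3 ^ (n + M) =
        (3 / 5) ^ M * ((3 / 5) ^ n * (12 * ‖h‖ * (ε / (12 * ‖h‖ + 1)))) := by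
      rw [← mul_assoc, ← pow_add, add_comm M n, div_pow]
      ring
    rw [h3] at h2
    have h4 : energy n h ≤ (3 / 5) ^ n * (12 * ‖h‖ * (ε / (12 * ‖h‖ + 1))) :=
      le_of_mul_le_mul_left h2 (by positivity)
    have h6 : 12 * ‖h‖ * (ε / (12 * ‖h‖ + 1)) ≤ ε := by
      rw [← mul_div_assoc, div_le_iff₀ hpos]
      nlinarith [norm_nonneg h]
    have h7 : ((3 : ℝ) / 5) ^ n ≤ 1 := pow_le_one₀ (by norm_num) (by norm_num)
    have h8 : 0 ≤ 12 * ‖h‖ * (ε / (12 * ‖h‖ + 1)) := by positivity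
    nlinarith
  rw [eq_const_of_diff_eq_zero hv h (fun m p hp => diff_eq_zero_of_energy_eq_zero (hE m) hp) x, h0]

/-- A harmonic map is determined by its value at a corner, its increments along the sides and
its degrees. -/
theorem IsHarmonicMap.eq_of_degree_eq {v : Fin 3 → Plane} (hv : IsEquilateral v)
    {f g : C(gasket v, UnitAddCircle)} (hf : IsHarmonicMap f) (hg : IsHarmonicMap g)
    (h0 : f (vertex v 0) = g (vertex v 0)) (hs : ∀ k, sideIncrement f k = sideIncrement g k)
    (hd : ∀ w, degree f w = degree g w) : f = g := by
  obtain ⟨h, hh⟩ := exists_toCircle_eq hv (f - g) fun w => by rw [degree_sub, hd, sub_self]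
  have hhx : ∀ x, (h x : UnitAddCircle) = f x - g x := fun x => DFunLike.congr_fun hh x
  have hside : ∀ k, h (vertex v (k + 1)) = h (vertex v k) := by
    intro k
    have := sideIncrement_toCircle h k
    rw [hh, sideIncrement_sub, hs, sub_self] at this
    linarith
  have hcorner : ∀ i, h (vertex v i) = h (vertex v 0) := by
    have h1 : h (vertex v 1) = h (vertex v 0) := hside 0
    have h2 : h (vertex v 2) = h (vertex v 1) := hside 1
    intro i
    fin_cases i
    exacts [rfl, h1, h2.trans h1]
  let h' : C(gasket v, ℝ) := h - ContinuousMap.const _ (h (vertex v 0))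
  have hdiff : diff h' = diff h := by
    funext p
    simp [diff, h']
  -- Differences of norm less than `1/4` have additive signed representatives, so at fine levels
  -- the Laplacian of `h` is the difference of those of `f` and `g`.
  obtain ⟨Mf, hMf⟩ := exists_edges_small hv f (ε := 1 / 4) (by norm_num)
  obtain ⟨Mg, hMg⟩ := exists_edges_small hv g (ε := 1 / 4) (by norm_num)
  obtain ⟨Mh, hMh⟩ := exists_discreteLaplacian_toCircle hv h
  have hlap : ∀ m, Mf ≤ m → Mg ≤ m → Mh ≤ m → ∀ x, starSum v m (diff h') x =
      discreteLaplacian m f x - discreteLaplacian m g x := by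
    intro m hf' hg' hh' x
    rw [hdiff, ← hMh m hh' x, hh]
    simp only [discreteLaplacian_eq_starSum]
    unfold starSum
    rw [eq_sub_iff_add_eq, ← edgeSum_add]
    refine edgeSum_congr fun p hp => ?_
    have h1 := hMf m hf' p hp
    have h2 := hMg m hg' p hp
    rw [dist_eq_norm] at h1 h2
    by_cases hpx : p.1 = x
    · simp only [if_pos hpx]
      rw [← eq_sub_iff_add_eq, ← signedRep_sub h1 h2]
      congr 1
      simp only [ContinuousMap.sub_apply]
      abel
    · simp [if_neg hpx]
  have hzero := eq_zero_of_laplacian_tendsto_zero hv h'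
    (fun i => by simp [h', hcorner]) fun ε hε => by
      obtain ⟨M₁, hM₁⟩ := hf.2 (ε / 2) (by positivity)
      obtain ⟨M₂, hM₂⟩ := hg.2 (ε / 2) (by positivity)
      refine ⟨Mf + Mg + Mh + M₁ + M₂, fun m hm x hx => ?_⟩
      rw [hlap m (by omega) (by omega) (by omega)]
      have e1 := hM₁ m (by omega) x hx
      have e2 := hM₂ m (by omega) x hx
      simp only [Pi.zero_apply, sub_zero, mul_assoc] at e1 e2
      have h5 : (0 : ℝ) < 5 ^ m := by positivity
      rw [show (5 : ℝ) ^ m * |discreteLaplacian m f x - discreteLaplacian m g x| =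
        |5 ^ m * discreteLaplacian m f x - 5 ^ m * discreteLaplacian m g x| by
          rw [← mul_sub, abs_mul, abs_of_pos h5]]
      rw [abs_lt] at e1 e2
      rw [abs_le]
      constructor <;> linarith
  ext x
  have h1 : h x = h (vertex v 0) := sub_eq_zero.1 (hzero x)
  rw [← sub_eq_zero, ← hhx, h1, hhx, h0, sub_self]

lemma length_le_loopIndex (w : List (Fin 3)) : w.length ≤ loopIndex w := by
  have key : ∀ (u : List ℕ) (n : ℕ), n + u.length ≤ u.foldl (fun n i => 3 * n + (i + 1)) n := by
    intro u
    induction u with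
    | nil => simp
    | cons i u ih =>
      intro n
      have := ih (3 * n + (i + 1))
      simp only [List.length_cons, List.foldl_cons]
      omega
  -- `loopIndex` folds over the list of natural numbers underlying `w`.
  simpa [loopIndex] using key (w.flatMap fun i => [(i : ℕ)]) 0

end SG

theorem theorem2p2 (v : Fin 3 → Plane) (hv : IsEquilateral v) (δ₁ δ₂ : ℝ) (ρ : ℕ →₀ ℤ)
    (a : UnitAddCircle) :
    ∃! f : C(SG.gasket v, UnitAddCircle),
      SG.IsHarmonicMap f ∧
      f (SG.vertex v 0) = a ∧
      (SG.sideIncrement f 0 = δ₁ ∧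
        SG.sideIncrement f 1 = δ₂ ∧
        SG.sideIncrement f 2 = (ρ 0 : ℝ) - δ₁ - δ₂) ∧
      ∀ w : List (Fin 3), SG.degree f w = (ρ (SG.loopIndex w) : ℝ) := by
  obtain ⟨κ, hκ⟩ := SG.exists_eventuallyHarmonic hv (ρ.support.sup id + 1)
    (fun w => ρ (SG.loopIndex w)) fun w hw => by
      by_contra h
      have h1 := Finset.le_sup (f := id) (Finsupp.mem_support_iff.2 h)
      have h2 := SG.length_le_loopIndex w
      simp only [id] at h1
      omega
  obtain ⟨f, h0, hs, hd, hh⟩ := hκ ![δ₁, δ₂, (ρ 0 : ℝ) - δ₁ - δ₂]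
    (by simp [Fin.sum_univ_three, SG.loopIndex]) a
  refine ⟨f, ⟨hh.isHarmonicMap, h0, ⟨hs 0, hs 1, hs 2⟩, hd⟩, ?_⟩
  rintro g ⟨gh, g0, ⟨gs0, gs1, gs2⟩, gd⟩
  refine gh.eq_of_degree_eq hv hh.isHarmonicMap (g0.trans h0.symm) (fun k => ?_)
    fun w => (gd w).trans (hd w).symm
  fin_cases k
  exacts [gs0.trans (hs 0).symm, gs1.trans (hs 1).symm, gs2.trans (hs 2).symm]
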